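/- Let $M$ be a smooth (finite-dimensional, Hausdorff) manifold without boundary. Let $\mathcal B^{(1)}$ be the Lie groupoid over $M$ whose arrows from $x$ to $y$ are the linear isomorphisms $T_xM\to T_yM$; equivalently, the 1-jets of local diffeomorphisms of $M$. A local bisection of $\mathcal B^{(1)}$ near $x$ is a smooth map $b:U\to\mathcal B^{(1)}$ on an open neighbourhood $U$ of $x$ with $b(z):T_zM\to T_{f(z)}M$ for all $z\in U$, where $f:U\to f(U)\subset M$ is a diffeomorphism onto an open subset. It acts on vector fields $Y$ by $b(Y)_{f(z)}=b(z)Y_z$. A $(1,1)$-jet at $x$ is the 1-jet $j^1_xb$ at $x$ of such a local bisection. It is semi-holonomic if $b(x)=j^1_xf$, and holonomic if it equals $j^1_x(z\mapsto j^1_z g)$ for some local diffeomorphism $g$ of $M$ defined near $x$, i.e. if it is a genuine 2-jet. A symmetry jet on $M$ is a smooth section $\mathfrak s$, $x\mapsto\mathfrak s(x)$, of the bundle of semi-holonomic $(1,1)$-jets over $M$ whose first order part is $-I$: if $\mathfrak s(x)=j^1_xs_x$, then $s_x(x)=-I_x:T_xM\to T_xM$, $X\mapsto -X$. It is called holonomic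 if $\mathfrak s(x)$ is holonomic for every $x\in M$. An affine connection on $M$ is an $\mathbb R$-bilinear map $(X,Y)\mapsto\nabla_XY$ on smooth vector fields with $\nabla_{fX}Y=f\nabla_XY$ and $\nabla_X(fY)=(Xf)Y+f\nabla_XY$ for all smooth functions $f$; it may have torsion. Proposition 2.2. For every symmetry jet $\mathfrak s$ the formula $$(\nabla^{\mathfrak s}_XY)_x=\tfrac12\,[X,\,Y+s_x(Y)]_x ,$$ where $s_x$ is any local bisection of $\mathcal B^{(1)}$ near $x$ with $\mathfrak s(x)=j^1_xs_x$, defines an affine connection $\nabla^{\mathfrak s}$ on $M$ (independently of the choice of the $s_x$). The map $\mathfrak s\mapsto\nabla^{\mathfrak s}$ is a bijection from the set of symmetry jets on $M$ onto the set of all affine connections on $M$. Moreover $\mathfrak s$ is holonomic if and only if $\nabla^{\mathfrak s}$ is torsion-free, that is, $\nabla^{\mathfrak s}_XY-\nabla^{\mathfrak s}_YX=[X,Y]$ for all smooth vector fields $X,Y$. -/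

import Mathlib

open scoped Manifold ContDiff Topology Bundle

noncomputable section

namespace SymJet

/-! ### Fibres of a pulled back vector bundle

The fibre of `f *ᵖ V` at `x` is `V (f x)`; it carries the structures of the latter. -/

section PullbackFibres

variable {B B' : Type*} {V : B → Type*} (f : B' → B)

instance pullbackAddCommGroup [i : ∀ b, AddCommGroup (V b)] (x : B') :
    AddCommGroup ((f *ᵖ V) x) :=
  inferInstanceAs (AddCommGroup (V (f x)))

instance pullbackIsTopologicalAddGroup [∀ b, AddCommGroup (V b)] [∀ b, TopologicalSpace (V b)]
    [i : ∀ b, IsTopologicalAddGroup (V b)] (x : B') : IsTopologicalAddGroup ((f *ᵖ V) x) :=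
  i (f x)

instance pullbackContinuousSMul [∀ b, AddCommGroup (V b)] [∀ b, Module ℝ (V b)]
    [∀ b, TopologicalSpace (V b)] [i : ∀ b, ContinuousSMul ℝ (V b)] (x : B') :
    ContinuousSMul ℝ ((f *ᵖ V) x) :=
  i (f x)

end PullbackFibres

/-! ### The manifold `J¹(M, N)` of 1-jets of maps -/

section JetSpace

variable {E : Type*} [NormedAddCommGroup E] [NormedSpace ℝ E]
  {H : Type*} [TopologicalSpace H] (I : ModelWithCorners ℝ E H)
  (M : Type*) [TopologicalSpace M] [ChartedSpace H M]
  {E' : Type*} [NormedAddCommGroup E'] [NormedSpace ℝ E']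
  {H' : Type*} [TopologicalSpace H'] (J : ModelWithCorners ℝ E' H')
  (N : Type*) [TopologicalSpace N] [ChartedSpace H' N]

/-- The vector bundle over `M × N` whose fibre over `(x, y)` is `Hom(T_x M, T_y N)`. -/
abbrev JetFiber (p : M × N) : Type _ :=
  ((ContMDiffMap.fst : C^∞⟮I.prod J, M × N; I, M⟯) *ᵖ (TangentSpace I : M → Type _)) p →L[ℝ]
  ((ContMDiffMap.snd : C^∞⟮I.prod J, M × N; J, N⟯) *ᵖ (TangentSpace J : N → Type _)) p

/-- The space `J¹(M, N)` of 1-jets of maps from `M` to `N`: a 1-jet consists of a source `x`,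
a target `y` and a linear map `T_x M → T_y N`. -/
def Jet1 : Type _ := Bundle.TotalSpace (E →L[ℝ] E') (JetFiber I M J N)

/-- The model space of the manifold `J¹(M, N)`. -/
abbrev JetH (E H E' H' : Type*) [NormedAddCommGroup E] [NormedSpace ℝ E] [TopologicalSpace H]
    [NormedAddCommGroup E'] [NormedSpace ℝ E'] [TopologicalSpace H'] : Type _ :=
  ModelProd (ModelProd H H') (E →L[ℝ] E')

/-- The model with corners of the manifold `J¹(M, N)`. -/
abbrev jetModel : ModelWithCorners ℝ ((E × E') × (E →L[ℝ] E')) (JetH E H E' H') :=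
  (I.prod J).prod 𝓘(ℝ, E →L[ℝ] E')

variable [IsManifold I ∞ M] [IsManifold J ∞ N]

/-- The topology, and below the smooth structure, of `J¹(M, N)` are those of the total space of the
smooth vector bundle `Hom(TM, TN)` over `M × N`. -/
instance : TopologicalSpace (Jet1 I M J N) :=
  inferInstanceAs (TopologicalSpace (Bundle.TotalSpace (E →L[ℝ] E') (JetFiber I M J N)))

instance : ChartedSpace (JetH E H E' H') (Jet1 I M J N) :=
  inferInstanceAs (ChartedSpace (ModelProd (ModelProd H H') (E →L[ℝ] E'))
    (Bundle.TotalSpace (E →L[ℝ] E') (JetFiber I M J N)))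

instance : IsManifold (jetModel I J) ∞ (Jet1 I M J N) :=
  inferInstanceAs (IsManifold ((I.prod J).prod 𝓘(ℝ, E →L[ℝ] E')) ∞
    (Bundle.TotalSpace (E →L[ℝ] E') (JetFiber I M J N)))

end JetSpace

namespace Jet1

variable {E : Type*} [NormedAddCommGroup E] [NormedSpace ℝ E]
  {H : Type*} [TopologicalSpace H] {I : ModelWithCorners ℝ E H}
  {M : Type*} [TopologicalSpace M] [ChartedSpace H M]
  {E' : Type*} [NormedAddCommGroup E'] [NormedSpace ℝ E']
  {H' : Type*} [TopologicalSpace H'] {J : ModelWithCorners ℝ E' H'}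
  {N : Type*} [TopologicalSpace N] [ChartedSpace H' N]
  {E'' : Type*} [NormedAddCommGroup E''] [NormedSpace ℝ E'']
  {H'' : Type*} [TopologicalSpace H''] (K : ModelWithCorners ℝ E'' H'')
  {P : Type*} [TopologicalSpace P] [ChartedSpace H'' P]

/-- The source of a 1-jet. -/
def src (ξ : Jet1 I M J N) : M := ξ.proj.1

/-- The target of a 1-jet. -/
def tgt (ξ : Jet1 I M J N) : N := ξ.proj.2

/-- The linear map `T_x M → T_y N` of a 1-jet with source `x` and target `y`. -/
def lin (ξ : Jet1 I M J N) : TangentSpace I ξ.src →L[ℝ] TangentSpace J ξ.tgt := ξ.snd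

/-- The 1-jet with given source, target and linear map. -/
def mk (x : M) (y : N) (L : TangentSpace I x →L[ℝ] TangentSpace J y) : Jet1 I M J N := ⟨(x, y), L⟩

variable (I J) in
/-- The 1-jet `j¹_x f` of a map `f`. -/
def ofMap (f : M → N) (x : M) : Jet1 I M J N := mk x (f x) (mfderiv I J f x)

/-- Composition of jets with a map `g : N → P`, that is `j¹_x f ↦ j¹_x (g ∘ f)`. -/
def postcomp (g : N → P) (ξ : Jet1 I M J N) : Jet1 I M K P :=
  mk ξ.src (g ξ.tgt) ((mfderiv J K g ξ.tgt).comp ξ.lin)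

end Jet1

/-! ### The groupoid of 1-jets of local diffeomorphisms and its 1-jet extension -/

section Groupoid

variable {E : Type*} [NormedAddCommGroup E] [NormedSpace ℝ E]
  {H : Type*} [TopologicalSpace H] (I : ModelWithCorners ℝ E H)
  (M : Type*) [TopologicalSpace M] [ChartedSpace H M] [IsManifold I ∞ M]

/-- The manifold `J¹(M, J¹(M, M))`, in which the non-holonomic (1,1)-jets lie. -/
abbrev Jet11 : Type _ := Jet1 I M (jetModel I I) (Jet1 I M I M)

/-- The model with corners of `J¹(M, J¹(M, M))`. -/
abbrev jet11Model := jetModel I (jetModel I I)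

variable {M} in
/-- The 1-jet `-I_x`, i.e. the linear map `X ↦ -X` from `T_x M` to itself. -/
def negId (x : M) : Jet1 I M I M := Jet1.mk x x (-ContinuousLinearMap.id ℝ (TangentSpace I x))

variable {M}

/-- A smooth local bisection, defined near `x`, of the Lie groupoid `B⁽¹⁾(Pair(M)) = GL(TM)` whose
arrows are the linear isomorphisms between tangent spaces of `M`, i.e. the 1-jets in `J¹(M, M)`
with invertible linear map: a smooth section of the source map over an open
neighbourhood `base.source` of `x` such that its composition with the target map is a
diffeomorphism onto an open subset of `M`. Values of `toFun` outside `base.source` are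
irrelevant. -/
structure LocalBisection (x : M) where
  toFun : M → Jet1 I M I M
  /-- the local diffeomorphism of `M` underlying the bisection -/
  base : PartialDiffeomorph I I M M ∞
  mem_source : x ∈ base.source
  contMDiffOn_toFun : ContMDiffOn I (jetModel I I) ∞ toFun base.source
  src_toFun : ∀ z ∈ base.source, (toFun z).src = z
  tgt_toFun : ∀ z ∈ base.source, (toFun z).tgt = base z
  isInvertible_lin : ∀ z ∈ base.source, (toFun z).lin.IsInvertible

namespace LocalBisection

variable {I} {x : M}

/-- The (1,1)-jet `j¹_x b` of a local bisection `b` of `GL(TM)` defined near `x`. -/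
def jet (b : LocalBisection I x) : Jet11 I M := Jet1.ofMap I (jetModel I I) b.toFun x

theorem tgt_toFun_symm (b : LocalBisection I x) {y : M} (hy : y ∈ b.base.target) :
    (b.toFun (b.base.toPartialEquiv.symm y)).tgt = y := by
  rw [b.tgt_toFun _ (b.base.toPartialEquiv.map_target hy)]
  exact b.base.toPartialEquiv.right_inv hy

open Classical in
/-- The local vector field `b(Y)` obtained by letting the bisection `b` act on the vector
field `Y`: writing `y = base z`, its value at `y` is the image of `Y z` under the linear map
`b z : T_z M → T_y M`. It is extended by zero outside the open image of the bisection. -/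
def act (b : LocalBisection I x) (Y : ∀ z : M, TangentSpace I z) (y : M) : TangentSpace I y :=
  if hy : y ∈ b.base.target then
    b.tgt_toFun_symm hy ▸
      (b.toFun (b.base.toPartialEquiv.symm y)).lin
        (Y (b.toFun (b.base.toPartialEquiv.symm y)).src)
  else 0

end LocalBisection

variable {I}

/-- The set `B⁽¹'¹⁾(Pair(M))` of (1,1)-jets: the 1-jets of local bisections of `GL(TM)`. -/
def IsJet11 (θ : Jet11 I M) : Prop := ∃ b : LocalBisection I θ.src, b.jet = θ

/-- The projection `p : j¹_x b ↦ b(x)`. -/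
def Jet11.p (θ : Jet11 I M) : Jet1 I M I M := θ.tgt

/-- The projection `p_* : j¹_x b ↦ j¹_x (p ∘ b)`, where `p ∘ b` is the local diffeomorphism of `M`
underlying `b`, that is the composition of `b` with the target map. -/
def Jet11.pStar (θ : Jet11 I M) : Jet1 I M I M := θ.postcomp I Jet1.tgt

/-- A semi-holonomic (1,1)-jet. -/
def IsSemiHolonomic (θ : Jet11 I M) : Prop := IsJet11 θ ∧ Jet11.p θ = Jet11.pStar θ

/-- A holonomic (1,1)-jet, that is a genuine 2-jet `j²_x f = j¹_x (z ↦ j¹_z f)` of a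
local diffeomorphism `f` of `M`. -/
def IsHolonomic (θ : Jet11 I M) : Prop :=
  ∃ f : PartialDiffeomorph I I M M ∞, θ.src ∈ f.source ∧
    θ = Jet1.ofMap I (jetModel I I) (fun z ↦ Jet1.ofMap I I f z) θ.src

variable (I M)

/-- A symmetry jet on `M`: a smooth section of the bundle of semi-holonomic (1,1)-jets over `M`
whose first order part is `-I`. -/
@[ext]
structure SymmetryJet where
  toFun : M → Jet11 I M
  contMDiff_toFun : ContMDiff I (jet11Model I) ∞ toFun
  src_toFun : ∀ x, (toFun x).src = x
  isSemiHolonomic : ∀ x, IsSemiHolonomic (toFun x)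
  p_toFun : ∀ x, Jet11.p (toFun x) = negId I x

variable {I M} in
/-- A symmetry jet is holonomic when it takes its values in the set of 2-jets. -/
def SymmetryJet.IsHolonomic (s : SymmetryJet I M) : Prop := ∀ x, SymJet.IsHolonomic (s.toFun x)

/-! ### Affine connections -/

/-- The space of smooth vector fields on `M`. -/
abbrev VField : Type _ := ContMDiffSection I E ∞ (TangentSpace I : M → Type _)

variable {I M} in
/-- The product of a smooth function and a smooth vector field. -/
def smulField (f : C^∞⟮I, M; ℝ⟯) (Y : VField I M) : VField I M :=
  ⟨fun x ↦ f x • Y x, f.contMDiff.smul_section Y.contMDiff⟩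

/-- An affine connection on `M`: an `ℝ`-bilinear map `(X, Y) ↦ ∇_X Y` on smooth vector
fields that is `C^∞(M)`-linear in `X` and satisfies the Leibniz rule in `Y`. -/
@[ext]
structure AffineConnection where
  toFun : VField I M →ₗ[ℝ] VField I M →ₗ[ℝ] VField I M
  smul_left : ∀ (f : C^∞⟮I, M; ℝ⟯) (X Y : VField I M),
    toFun (smulField f X) Y = smulField f (toFun X Y)
  leibniz : ∀ (f : C^∞⟮I, M; ℝ⟯) (X Y : VField I M) (x : M),
    toFun X (smulField f Y) x = mvfderiv I f x (X x) • Y x + f x • toFun X Y x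

variable {I M} in
/-- The torsion `∇_X Y - ∇_Y X - [X, Y]` vanishes. -/
def AffineConnection.IsTorsionFree (D : AffineConnection I M) : Prop :=
  ∀ (X Y : VField I M) (x : M),
    D.toFun X Y x - D.toFun Y X x - VectorField.mlieBracket I X Y x = 0

end Groupoid

end SymJet

end

/-! In the preferred chart at `x₀`, a local bisection near `x` is a map `z ↦ (f z, A z)`, with `A z`
an endomorphism of `E`. If its jet is semi-holonomic with first order part `-I`, then `f x = x`, `Df
= -I` and `A x = -I`. All that remains of the jet is `Γ = DA` at `x`, a bilinear map on `E` that can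
be prescribed arbitrarily. This is `gam`; `IsSymmetricAt.eq_of_gam_eq` gives uniqueness and
`gam_symJet` existence.

Near `x` one has `b(Y) = (A Y) ∘ f⁻¹`, so `D(b(Y)) v = DY v - Γ(v, Y)` at `x`. Moreover `Y + b(Y)`
vanishes at `x`, so no derivative of `X` enters the bracket, and half of it is `DY X - ½ Γ(X, Y)`
(`tcoord_mlieBracket_act`). The right side depends on `b` only through its jet and is visibly an
affine connection.

Conversely, a connection is local and has Christoffel symbols (`AffineConnection.coord_toFun`).
Setting `Γ` equal to `-2` times these symbols gives the inverse map. The connection at `x`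
determines `Γ` (`gam_eq_of_chartNabla_eq`), so the resulting jet does not depend on the chart, which
also yields smoothness.

In coordinates the torsion is `½ (Γ(Y, X) - Γ(X, Y))`, so it vanishes exactly when `Γ` is symmetric.
For a genuine 2-jet `Γ` is a second derivative, hence symmetric. A symmetric `Γ` is the second
derivative of a quadratic map, which the inverse function theorem turns into a local diffeomorphism.
-/

noncomputable section

namespace SymJet

open Bundle

/-! ### Trivializations of pulled back tangent bundles. -/

section Pullback

variable {E : Type*} [NormedAddCommGroup E] [NormedSpace ℝ E] {H : Type*} [TopologicalSpace H]
  {I : ModelWithCorners ℝ E H} {M : Type*} [TopologicalSpace M] [ChartedSpace H M]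
  [IsManifold I ∞ M] {B : Type*} [TopologicalSpace B] {K : Type*} [FunLike K B M]
  [ContinuousMapClass K B M] (f : K)
  (e : Trivialization E (π E (TangentSpace I : M → Type _))) [e.IsLinear ℝ] {b : B}

theorem pullback_continuousLinearMapAt (h : f b ∈ e.baseSet)
    (v : ((f : B → M) *ᵖ (TangentSpace I : M → Type _)) b) :
    (e.pullback f).continuousLinearMapAt ℝ b v = e.continuousLinearMapAt ℝ (f b) v := by
  have h' : b ∈ (e.pullback f).baseSet := h
  refine (congrFun ((e.pullback f).continuousLinearMapAt_apply ℝ b) v).trans ?_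
  refine (congrFun ((e.pullback f).coe_linearMapAt_of_mem (R := ℝ) h') v).trans ?_
  refine Eq.symm ((congrFun (e.continuousLinearMapAt_apply ℝ (f b)) v).trans ?_)
  exact congrFun (e.coe_linearMapAt_of_mem h) v

theorem pullback_symmL (h : f b ∈ e.baseSet) (v : E) :
    (e.pullback f).symmL ℝ b v = e.symmL ℝ (f b) v := by
  have h' : b ∈ (e.pullback f).baseSet := h
  refine (e.symmL_continuousLinearMapAt (R := ℝ) h ((e.pullback f).symmL ℝ b v)).symm.trans ?_
  refine congrArg (e.symmL ℝ (f b)) ?_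
  exact (pullback_continuousLinearMapAt f e h _).symm.trans
    ((e.pullback f).continuousLinearMapAt_symmL h' v)

end Pullback

/-! ### Smoothness of maps into a space of 1-jets. -/

section JetSmooth

variable {E : Type*} [NormedAddCommGroup E] [NormedSpace ℝ E]
  {H : Type*} [TopologicalSpace H] {I : ModelWithCorners ℝ E H}
  {M : Type*} [TopologicalSpace M] [ChartedSpace H M] [IsManifold I ∞ M]
  {E' : Type*} [NormedAddCommGroup E'] [NormedSpace ℝ E']
  {H' : Type*} [TopologicalSpace H'] {J : ModelWithCorners ℝ E' H'}
  {N : Type*} [TopologicalSpace N] [ChartedSpace H' N] [IsManifold J ∞ N]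

theorem trivializationAt_jet_apply (p : M × N) (ξ : TotalSpace (E →L[ℝ] E') (JetFiber I M J N))
    (h₁ : ξ.proj.1 ∈ (chartAt H p.1).source) (h₂ : ξ.proj.2 ∈ (chartAt H' p.2).source) :
    (trivializationAt (E →L[ℝ] E') (JetFiber I M J N) p ξ).2 =
      ContinuousLinearMap.inCoordinates E (TangentSpace I : M → Type _) E'
        (TangentSpace J : N → Type _) p.1 ξ.proj.1 p.2 ξ.proj.2 ξ.snd := by
  rw [hom_trivializationAt_apply]
  ext v
  refine (pullback_continuousLinearMapAt (ContMDiffMap.snd : C^∞⟮I.prod J, M × N; J, N⟯)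
    (trivializationAt E' (TangentSpace J : N → Type _) p.2) h₂ _).trans ?_
  refine congrArg (fun w ↦
    (trivializationAt E' (TangentSpace J : N → Type _) p.2).continuousLinearMapAt
    ℝ ξ.proj.2 (ξ.snd w)) ?_
  exact pullback_symmL (ContMDiffMap.fst : C^∞⟮I.prod J, M × N; I, M⟯)
    (trivializationAt E (TangentSpace I : M → Type _) p.1) h₁ _

variable {F : Type*} [NormedAddCommGroup F] [NormedSpace ℝ F] {G : Type*} [TopologicalSpace G]
  {K : ModelWithCorners ℝ F G} {P : Type*} [TopologicalSpace P] [ChartedSpace G P]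

/-- Smoothness of a map to a space of 1-jets, in terms of the coordinates of the linear part. -/
theorem contMDiffAt_jet_iff_inCoordinates {g : P → Jet1 I M J N} {p : P} {x₀ : M} {y₀ : N}
    (h₁ : (g p).src ∈ (chartAt H x₀).source) (h₂ : (g p).tgt ∈ (chartAt H' y₀).source) :
    ContMDiffAt K (jetModel I J) ∞ g p ↔
      ContMDiffAt K I ∞ (fun q ↦ (g q).src) p ∧ ContMDiffAt K J ∞ (fun q ↦ (g q).tgt) p ∧
      ContMDiffAt K 𝓘(ℝ, E →L[ℝ] E') ∞ (fun q ↦ ContinuousLinearMap.inCoordinates E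
        (TangentSpace I : M → Type _) E' (TangentSpace J : N → Type _) x₀ (g q).src y₀ (g q).tgt
          (g q).lin) p := by
  have := Trivialization.contMDiffAt_iff (IB := I.prod J) (n := ∞) (IM := K)
    (e := trivializationAt (E →L[ℝ] E') (JetFiber I M J N) (x₀, y₀)) (f := g) (x₀ := p)
    ((Trivialization.mem_source _).2 ⟨h₁, h₂⟩)
  have h := this.trans (and_congr_left' (contMDiffAt_prod_iff _))
  rw [and_assoc] at h
  -- The two expressions agree only over the chart domains, so continuity of the source and target
  -- is needed to make them agree near `p`.
  have key : ContMDiffAt K I ∞ (fun q ↦ (g q).src) p → ContMDiffAt K J ∞ (fun q ↦ (g q).tgt) p →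
      (fun q ↦ (trivializationAt (E →L[ℝ] E') (JetFiber I M J N) (x₀, y₀) (g q)).2) =ᶠ[𝓝 p]
      (fun q ↦ ContinuousLinearMap.inCoordinates E
        (TangentSpace I : M → Type _) E' (TangentSpace J : N → Type _) x₀ (g q).src y₀ (g q).tgt
          (g q).lin) := fun hs ht ↦ by
    filter_upwards [hs.continuousAt.preimage_mem_nhds ((chartAt H x₀).open_source.mem_nhds h₁),
      ht.continuousAt.preimage_mem_nhds ((chartAt H' y₀).open_source.mem_nhds h₂)] with q hq₁ hq₂
    exact trivializationAt_jet_apply (x₀, y₀) (g q) hq₁ hq₂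
  refine ⟨fun hg ↦ ?_, fun hg ↦ h.2 ⟨hg.1, hg.2.1, hg.2.2.congr_of_eventuallyEq (key hg.1 hg.2.1)⟩⟩
  have := h.1 hg
  exact ⟨this.1, this.2.1, this.2.2.congr_of_eventuallyEq (key this.1 this.2.1).symm⟩

end JetSmooth

/-! ### Coordinates on tangent spaces and on `J¹(M, M)`. -/

section Coordinates

variable {E : Type*} [NormedAddCommGroup E] [NormedSpace ℝ E]
  {M : Type*} [TopologicalSpace M] [ChartedSpace E M] [IsManifold 𝓘(ℝ, E) ∞ M]

/-- The coordinates of tangent vectors at `z` given by the preferred chart at `x₀`. -/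
def tcoord (x₀ z : M) : TangentSpace 𝓘(ℝ, E) z →L[ℝ] E :=
  (trivializationAt E (TangentSpace 𝓘(ℝ, E) : M → Type _) x₀).continuousLinearMapAt ℝ z

/-- The tangent vector at `z` with given coordinates in the preferred chart at `x₀`. -/
def tvec (x₀ z : M) : E →L[ℝ] TangentSpace 𝓘(ℝ, E) z :=
  (trivializationAt E (TangentSpace 𝓘(ℝ, E) : M → Type _) x₀).symmL ℝ z

theorem tcoord_tvec {x₀ z : M} (hz : z ∈ (chartAt E x₀).source) (v : E) :
    tcoord x₀ z (tvec x₀ z v) = v :=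
  (trivializationAt E (TangentSpace 𝓘(ℝ, E) : M → Type _) x₀).continuousLinearMapAt_symmL
    (by simpa using hz) v

theorem tvec_tcoord {x₀ z : M} (hz : z ∈ (chartAt E x₀).source) (v : TangentSpace 𝓘(ℝ, E) z) :
    tvec x₀ z (tcoord x₀ z v) = v :=
  (trivializationAt E (TangentSpace 𝓘(ℝ, E) : M → Type _) x₀).symmL_continuousLinearMapAt
    (by simpa using hz) v

/-- One chart serves both source and target: only jets near some `-I_x` matter, and their two ends
are close together. -/
def jcoord (x₀ : M) (ξ : Jet1 𝓘(ℝ, E) M 𝓘(ℝ, E) M) : E →L[ℝ] E :=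
  (tcoord x₀ ξ.tgt).comp (ξ.lin.comp (tvec x₀ ξ.src))

variable {F : Type*} [NormedAddCommGroup F] [NormedSpace ℝ F] {H : Type*} [TopologicalSpace H]
  {J : ModelWithCorners ℝ F H} {N : Type*} [TopologicalSpace N] [ChartedSpace H N]

theorem contMDiffAt_jet_iff {g : N → Jet1 𝓘(ℝ, E) M 𝓘(ℝ, E) M} {p : N} {x₀ : M}
    (h₁ : (g p).src ∈ (chartAt E x₀).source) (h₂ : (g p).tgt ∈ (chartAt E x₀).source) :
    ContMDiffAt J (jetModel 𝓘(ℝ, E) 𝓘(ℝ, E)) ∞ g p ↔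
      ContMDiffAt J 𝓘(ℝ, E) ∞ (fun q ↦ (g q).src) p ∧
      ContMDiffAt J 𝓘(ℝ, E) ∞ (fun q ↦ (g q).tgt) p ∧
      ContMDiffAt J 𝓘(ℝ, E →L[ℝ] E) ∞ (fun q ↦ jcoord x₀ (g q)) p :=
  contMDiffAt_jet_iff_inCoordinates h₁ h₂

theorem contMDiffAt_section_coord {V : ∀ z : M, TangentSpace 𝓘(ℝ, E) z} {x₀ x : M}
    (hx : x ∈ (chartAt E x₀).source) :
    ContMDiffAt 𝓘(ℝ, E) (𝓘(ℝ, E).prod 𝓘(ℝ, E)) ∞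
      (fun z ↦ (⟨z, V z⟩ : TotalSpace E (TangentSpace 𝓘(ℝ, E) : M → Type _))) x ↔
    ContMDiffAt 𝓘(ℝ, E) 𝓘(ℝ, E) ∞ (fun z ↦ tcoord x₀ z (V z)) x := by
  refine (Trivialization.contMDiffAt_section_iff
    (trivializationAt E (TangentSpace 𝓘(ℝ, E) : M → Type _) x₀) hx).trans ?_
  refine Filter.EventuallyEq.contMDiffAt_iff ?_
  filter_upwards [(chartAt E x₀).open_source.mem_nhds hx] with z hz
  rw [tcoord, Trivialization.continuousLinearMapAt_apply, Trivialization.linearMapAt_apply, if_pos]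
  exact hz

theorem contMDiff_jet_proj : ContMDiff (jetModel 𝓘(ℝ, E) 𝓘(ℝ, E)) (𝓘(ℝ, E).prod 𝓘(ℝ, E)) ∞
    (fun ξ : Jet1 𝓘(ℝ, E) M 𝓘(ℝ, E) M ↦ (ξ.proj : M × M)) := by
  intro ξ
  exact contMDiffAt_proj (n := ∞) (F := E →L[ℝ] E) (IB := 𝓘(ℝ, E).prod 𝓘(ℝ, E))
    (fun p : M × M ↦ JetFiber 𝓘(ℝ, E) M 𝓘(ℝ, E) M p)

theorem contMDiff_src : ContMDiff (jetModel 𝓘(ℝ, E) 𝓘(ℝ, E)) 𝓘(ℝ, E) ∞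
    (Jet1.src : Jet1 𝓘(ℝ, E) M 𝓘(ℝ, E) M → M) :=
  contMDiff_fst.comp (contMDiff_jet_proj (M := M))

theorem contMDiff_tgt : ContMDiff (jetModel 𝓘(ℝ, E) 𝓘(ℝ, E)) 𝓘(ℝ, E) ∞
    (Jet1.tgt : Jet1 𝓘(ℝ, E) M 𝓘(ℝ, E) M → M) :=
  contMDiff_snd.comp (contMDiff_jet_proj (M := M))

theorem contMDiffAt_jcoord {x₀ : M} {ξ : Jet1 𝓘(ℝ, E) M 𝓘(ℝ, E) M}
    (h₁ : ξ.src ∈ (chartAt E x₀).source) (h₂ : ξ.tgt ∈ (chartAt E x₀).source) :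
    ContMDiffAt (jetModel 𝓘(ℝ, E) 𝓘(ℝ, E)) 𝓘(ℝ, E →L[ℝ] E) ∞ (jcoord x₀) ξ :=
  ((contMDiffAt_jet_iff (g := id) h₁ h₂).1 contMDiffAt_id).2.2

/-- The 1-jet with given source, target and coordinates of its linear part. -/
def ofCoord (x₀ : M) (p : (M × M) × (E →L[ℝ] E)) : Jet1 𝓘(ℝ, E) M 𝓘(ℝ, E) M :=
  Jet1.mk p.1.1 p.1.2 ((tvec x₀ p.1.2).comp (p.2.comp (tcoord x₀ p.1.1)))

theorem jcoord_ofCoord {x₀ : M} {p : (M × M) × (E →L[ℝ] E)}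
    (h₁ : p.1.1 ∈ (chartAt E x₀).source) (h₂ : p.1.2 ∈ (chartAt E x₀).source) :
    jcoord x₀ (ofCoord x₀ p) = p.2 := by
  ext v
  change tcoord x₀ p.1.2 (tvec x₀ p.1.2 (p.2 (tcoord x₀ p.1.1 (tvec x₀ p.1.1 v)))) = p.2 v
  rw [tcoord_tvec h₂, tcoord_tvec h₁]

theorem ofCoord_jcoord {x₀ : M} {ξ : Jet1 𝓘(ℝ, E) M 𝓘(ℝ, E) M}
    (h₁ : ξ.src ∈ (chartAt E x₀).source) (h₂ : ξ.tgt ∈ (chartAt E x₀).source) :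
    ofCoord x₀ ((ξ.src, ξ.tgt), jcoord x₀ ξ) = ξ := by
  change Jet1.mk ξ.src ξ.tgt _ = Jet1.mk ξ.src ξ.tgt ξ.lin
  congr 1
  ext v
  change tvec x₀ ξ.tgt (tcoord x₀ ξ.tgt (ξ.lin (tvec x₀ ξ.src (tcoord x₀ ξ.src v)))) = ξ.lin v
  rw [tvec_tcoord h₂, tvec_tcoord h₁]

theorem contMDiffAt_ofCoord {x₀ : M} {p : (M × M) × (E →L[ℝ] E)}
    (h₁ : p.1.1 ∈ (chartAt E x₀).source) (h₂ : p.1.2 ∈ (chartAt E x₀).source) :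
    ContMDiffAt (jetModel 𝓘(ℝ, E) 𝓘(ℝ, E)) (jetModel 𝓘(ℝ, E) 𝓘(ℝ, E)) ∞ (ofCoord x₀) p := by
  refine (contMDiffAt_jet_iff (x₀ := x₀) h₁ h₂).2 ⟨contMDiffAt_fst.comp p contMDiffAt_fst,
    contMDiffAt_snd.comp p contMDiffAt_fst, ?_⟩
  refine (contMDiffAt_snd (I := 𝓘(ℝ, E).prod 𝓘(ℝ, E)) (M := M × M)
    (J := 𝓘(ℝ, E →L[ℝ] E))).congr_of_eventuallyEq ?_
  have h : ((chartAt E x₀).source ×ˢ (chartAt E x₀).source) ×ˢ (Set.univ : Set (E →L[ℝ] E)) ∈ 𝓝 p :=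
    (((chartAt E x₀).open_source.prod (chartAt E x₀).open_source).prod isOpen_univ).mem_nhds
      ⟨⟨h₁, h₂⟩, trivial⟩
  filter_upwards [h] with q hq
  exact jcoord_ofCoord hq.1.1 hq.1.2

/-- Near `ξ`, `ofCoord x₀` is a left inverse of the triple (source, target, `jcoord x₀`);
differentiating this identity shows that the three derivatives determine a tangent vector. -/
theorem mfderiv_coord_injective {x₀ : M} {ξ : Jet1 𝓘(ℝ, E) M 𝓘(ℝ, E) M}
    (h₁ : ξ.src ∈ (chartAt E x₀).source) (h₂ : ξ.tgt ∈ (chartAt E x₀).source)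
    {v w : TangentSpace (jetModel 𝓘(ℝ, E) 𝓘(ℝ, E)) ξ}
    (hs : mfderiv (jetModel 𝓘(ℝ, E) 𝓘(ℝ, E)) 𝓘(ℝ, E) Jet1.src ξ v =
      mfderiv (jetModel 𝓘(ℝ, E) 𝓘(ℝ, E)) 𝓘(ℝ, E) Jet1.src ξ w)
    (ht : mfderiv (jetModel 𝓘(ℝ, E) 𝓘(ℝ, E)) 𝓘(ℝ, E) Jet1.tgt ξ v =
      mfderiv (jetModel 𝓘(ℝ, E) 𝓘(ℝ, E)) 𝓘(ℝ, E) Jet1.tgt ξ w)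
    (hc : mvfderiv (jetModel 𝓘(ℝ, E) 𝓘(ℝ, E)) (jcoord x₀) ξ v =
      mvfderiv (jetModel 𝓘(ℝ, E) 𝓘(ℝ, E)) (jcoord x₀) ξ w) : v = w := by
  have ds := (contMDiff_src (M := M) ξ).mdifferentiableAt (by simp)
  have dt := (contMDiff_tgt (M := M) ξ).mdifferentiableAt (by simp)
  have dc := (contMDiffAt_jcoord h₁ h₂).mdifferentiableAt (by simp)
  have dr := (contMDiffAt_ofCoord (p := ((ξ.src, ξ.tgt), jcoord x₀ ξ)) h₁ h₂).mdifferentiableAt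
    (by simp)
  have hid : ofCoord x₀ ∘
      (fun η : Jet1 𝓘(ℝ, E) M 𝓘(ℝ, E) M ↦ ((η.src, η.tgt), jcoord x₀ η)) =ᶠ[𝓝 ξ] id := by
    filter_upwards [(contMDiff_src (M := M) ξ).continuousAt.preimage_mem_nhds
      ((chartAt E x₀).open_source.mem_nhds h₁),
      (contMDiff_tgt (M := M) ξ).continuousAt.preimage_mem_nhds
      ((chartAt E x₀).open_source.mem_nhds h₂)] with η hη₁ hη₂
    exact ofCoord_jcoord hη₁ hη₂
  have key := hid.mfderiv_eq (I := jetModel 𝓘(ℝ, E) 𝓘(ℝ, E)) (I' := jetModel 𝓘(ℝ, E) 𝓘(ℝ, E))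
  rw [mfderiv_comp ξ dr ((ds.prodMk dt).prodMk dc), mfderiv_id, mfderiv_prodMk (ds.prodMk dt) dc,
    mfderiv_prodMk ds dt] at key
  have hv := congrArg (fun A ↦ A v) key
  have hw := congrArg (fun A ↦ A w) key
  refine hv.symm.trans (Eq.trans ?_ hw)
  refine congrArg (mfderiv (jetModel 𝓘(ℝ, E) 𝓘(ℝ, E)) (jetModel 𝓘(ℝ, E) 𝓘(ℝ, E)) (ofCoord x₀)
    ((ξ.src, ξ.tgt), jcoord x₀ ξ)) ?_
  exact Prod.ext (Prod.ext hs ht) hc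

theorem tcoord_eq_mvfderiv {x₀ z : M} (hz : z ∈ (chartAt E x₀).source) :
    tcoord x₀ z = mvfderiv 𝓘(ℝ, E) (extChartAt 𝓘(ℝ, E) x₀) z := by
  rw [tcoord, TangentBundle.continuousLinearMapAt_trivializationAt hz]
  rfl
end Coordinates

/-! ### Symmetric (1,1)-jets and their second order part. -/

section SymmetricJets

variable {E : Type*} [NormedAddCommGroup E] [NormedSpace ℝ E]
  {M : Type*} [TopologicalSpace M] [ChartedSpace E M]

section

variable {F : Type*} [NormedAddCommGroup F] [NormedSpace ℝ F] {H : Type*} [TopologicalSpace H]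
  {J : ModelWithCorners ℝ F H} {N : Type*} [TopologicalSpace N] [ChartedSpace H N]
  {F' : Type*} [NormedAddCommGroup F'] [NormedSpace ℝ F'] {H' : Type*} [TopologicalSpace H']
  {K : ModelWithCorners ℝ F' H'} {P : Type*} [TopologicalSpace P] [ChartedSpace H' P]

theorem Jet1.mk_injective {x : M} {y : N} {L L' : TangentSpace 𝓘(ℝ, E) x →L[ℝ] TangentSpace J y}
    (h : (Jet1.mk x y L : Jet1 𝓘(ℝ, E) M J N) = Jet1.mk x y L') : L = L' := by
  injection h

theorem Jet1.exists_eq_mk {x : M} {y : N} {ξ : Jet1 𝓘(ℝ, E) M J N} (hx : ξ.src = x)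
    (hy : ξ.tgt = y) :
    ∃ L : TangentSpace 𝓘(ℝ, E) x →L[ℝ] TangentSpace J y, ξ = Jet1.mk x y L := by
  subst hx hy
  exact ⟨ξ.lin, rfl⟩

theorem Jet1.postcomp_ofMap {g : M → N} {f : N → P} {x : M} (hf : MDifferentiableAt J K f (g x))
    (hg : MDifferentiableAt 𝓘(ℝ, E) J g x) :
    (Jet1.ofMap 𝓘(ℝ, E) J g x).postcomp K f = Jet1.ofMap 𝓘(ℝ, E) K (f ∘ g) x := by
  refine congrArg (Jet1.mk x (f (g x))) ?_
  exact (mfderiv_comp x hf hg).symm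

theorem Jet1.ofMap_congr {g g' : M → N} {x : M} (h : g =ᶠ[𝓝 x] g') :
    Jet1.ofMap 𝓘(ℝ, E) J g x = Jet1.ofMap 𝓘(ℝ, E) J g' x := by
  have aux : ∀ y y' : N, y = y' → ∀ L L' : E →L[ℝ] F, L = L' →
      (Jet1.mk x y L : Jet1 𝓘(ℝ, E) M J N) = Jet1.mk x y' L' := by
    rintro y _ rfl L _ rfl
    rfl
  exact aux _ _ h.eq_of_nhds _ _ h.mfderiv_eq

end

variable [IsManifold 𝓘(ℝ, E) ∞ M]

/-- A (1,1)-jet at `x` which lies over `-I_x`, and projects to `-I_x`. -/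
structure IsSymmetricAt (x : M) (θ : Jet11 𝓘(ℝ, E) M) : Prop where
  src_eq : θ.src = x
  tgt_eq : θ.tgt = negId 𝓘(ℝ, E) x
  postcomp_src : θ.postcomp 𝓘(ℝ, E) Jet1.src =
    Jet1.mk x x (ContinuousLinearMap.id ℝ (TangentSpace 𝓘(ℝ, E) x))
  postcomp_tgt : θ.postcomp 𝓘(ℝ, E) Jet1.tgt = negId 𝓘(ℝ, E) x

/-- The second order part of a (1,1)-jet in the preferred chart at `x₀`. -/
def gam (x₀ : M) (θ : Jet11 𝓘(ℝ, E) M) : E →L[ℝ] E →L[ℝ] E :=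
  (mvfderiv (jetModel 𝓘(ℝ, E) 𝓘(ℝ, E)) (jcoord x₀) θ.tgt).comp (θ.lin.comp (tvec x₀ θ.src))

theorem gam_mk (x₀ x : M) (ξ : Jet1 𝓘(ℝ, E) M 𝓘(ℝ, E) M)
    (L : TangentSpace 𝓘(ℝ, E) x →L[ℝ] TangentSpace (jetModel 𝓘(ℝ, E) 𝓘(ℝ, E)) ξ) (v : E) :
    gam x₀ (Jet1.mk x ξ L) v =
      mvfderiv (jetModel 𝓘(ℝ, E) 𝓘(ℝ, E)) (jcoord x₀) ξ (L (tvec x₀ x v)) := rfl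

/-- Symmetry already fixes the derivatives of the source (`id`) and of the target (`-id`), so the
derivative of `jcoord` is the only freedom left. -/
theorem IsSymmetricAt.eq_of_gam_eq {x₀ x : M} (hx : x ∈ (chartAt E x₀).source)
    {θ θ' : Jet11 𝓘(ℝ, E) M} (h : IsSymmetricAt x θ) (h' : IsSymmetricAt x θ')
    (hg : gam x₀ θ = gam x₀ θ') : θ = θ' := by
  obtain ⟨L, rfl⟩ := Jet1.exists_eq_mk h.src_eq h.tgt_eq
  obtain ⟨L', rfl⟩ := Jet1.exists_eq_mk h'.src_eq h'.tgt_eq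
  have hs := Jet1.mk_injective (h.postcomp_src.trans h'.postcomp_src.symm)
  have ht := Jet1.mk_injective (h.postcomp_tgt.trans h'.postcomp_tgt.symm)
  congr 1
  ext v
  refine mfderiv_coord_injective (x₀ := x₀) (ξ := negId 𝓘(ℝ, E) x) hx hx
    (DFunLike.congr_fun hs v) (DFunLike.congr_fun ht v) ?_
  have := DFunLike.congr_fun hg (tcoord x₀ x v)
  rw [gam_mk, gam_mk, tvec_tcoord hx] at this
  exact this

theorem isSymmetricAt_ofMap {x : M} {g : M → Jet1 𝓘(ℝ, E) M 𝓘(ℝ, E) M}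
    (hg : MDifferentiableAt 𝓘(ℝ, E) (jetModel 𝓘(ℝ, E) 𝓘(ℝ, E)) g x)
    (h0 : g x = negId 𝓘(ℝ, E) x) (hs : ∀ᶠ z in 𝓝 x, (g z).src = z)
    (ht : Jet1.ofMap 𝓘(ℝ, E) 𝓘(ℝ, E) (fun z ↦ (g z).tgt) x = negId 𝓘(ℝ, E) x) :
    IsSymmetricAt x (Jet1.ofMap 𝓘(ℝ, E) (jetModel 𝓘(ℝ, E) 𝓘(ℝ, E)) g x) where
  src_eq := rfl
  tgt_eq := h0
  postcomp_src := by
    rw [Jet1.postcomp_ofMap ((contMDiff_src (M := M) _).mdifferentiableAt (by simp)) hg]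
    exact (Jet1.ofMap_congr (g' := id) hs).trans (congrArg (Jet1.mk x x) mfderiv_id)
  postcomp_tgt := by
    rw [Jet1.postcomp_ofMap ((contMDiff_tgt (M := M) _).mdifferentiableAt (by simp)) hg]
    exact ht

theorem gam_ofMap {x₀ x : M} {g : M → Jet1 𝓘(ℝ, E) M 𝓘(ℝ, E) M}
    (hg : MDifferentiableAt 𝓘(ℝ, E) (jetModel 𝓘(ℝ, E) 𝓘(ℝ, E)) g x)
    (hs : (g x).src ∈ (chartAt E x₀).source) (ht : (g x).tgt ∈ (chartAt E x₀).source) (v : E) :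
    gam x₀ (Jet1.ofMap 𝓘(ℝ, E) (jetModel 𝓘(ℝ, E) 𝓘(ℝ, E)) g x) v =
      mvfderiv 𝓘(ℝ, E) (fun z ↦ jcoord x₀ (g z)) x (tvec x₀ x v) := by
  have := mfderiv_comp x ((contMDiffAt_jcoord hs ht).mdifferentiableAt (by simp)) hg
  exact (DFunLike.congr_fun this (tvec x₀ x v)).symm

theorem LocalBisection.contMDiffAt {x : M} (b : LocalBisection 𝓘(ℝ, E) x) :
    ContMDiffAt 𝓘(ℝ, E) (jetModel 𝓘(ℝ, E) 𝓘(ℝ, E)) ∞ b.toFun x :=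
  b.contMDiffOn_toFun.contMDiffAt (b.base.open_source.mem_nhds b.mem_source)

theorem LocalBisection.isSymmetricAt_jet {x : M} (b : LocalBisection 𝓘(ℝ, E) x)
    (h0 : b.toFun x = negId 𝓘(ℝ, E) x)
    (ht : Jet1.ofMap 𝓘(ℝ, E) 𝓘(ℝ, E) b.base x = negId 𝓘(ℝ, E) x) : IsSymmetricAt x b.jet := by
  have hU := b.base.open_source.mem_nhds b.mem_source
  refine isSymmetricAt_ofMap (b.contMDiffAt.mdifferentiableAt (by simp)) h0 ?_ ?_
  · filter_upwards [hU] with z hz using b.src_toFun z hz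
  · rw [← ht]
    apply Jet1.ofMap_congr
    filter_upwards [hU] with z hz using b.tgt_toFun z hz

/-- The source conditions are automatic for a bisection, which is a section of the source map near
`x`; the other two say semi-holonomic over `-I_x`. -/
theorem LocalBisection.isSymmetricAt_iff {x : M} (b : LocalBisection 𝓘(ℝ, E) x) :
    IsSymmetricAt x b.jet ↔
      Jet11.p b.jet = negId 𝓘(ℝ, E) x ∧ Jet11.pStar b.jet = negId 𝓘(ℝ, E) x := by
  refine ⟨fun h ↦ ⟨h.tgt_eq, h.postcomp_tgt⟩, fun h ↦ b.isSymmetricAt_jet h.1 ?_⟩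
  have hU := b.base.open_source.mem_nhds b.mem_source
  rw [← h.2]
  refine Eq.trans ?_ (Jet1.postcomp_ofMap ((contMDiff_tgt (M := M) _).mdifferentiableAt (by simp))
    (b.contMDiffAt.mdifferentiableAt (by simp))).symm
  apply Jet1.ofMap_congr
  filter_upwards [hU] with z hz using (b.tgt_toFun z hz).symm

theorem IsSemiHolonomic.isSymmetricAt {x : M} {θ : Jet11 𝓘(ℝ, E) M} (h : IsSemiHolonomic θ)
    (hs : θ.src = x) (hp : Jet11.p θ = negId 𝓘(ℝ, E) x) : IsSymmetricAt x θ := by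
  subst hs
  obtain ⟨⟨b, hb⟩, h'⟩ := h
  rw [hp] at h'
  have := b.isSymmetricAt_iff
  rw [hb] at this
  exact this.2 ⟨hp, h'.symm⟩

theorem IsSymmetricAt.isSemiHolonomic {x : M} {b : LocalBisection 𝓘(ℝ, E) x}
    (h : IsSymmetricAt x b.jet) : IsSemiHolonomic b.jet :=
  ⟨⟨b, rfl⟩, h.tgt_eq.trans h.postcomp_tgt.symm⟩

theorem SymmetryJet.isSymmetricAt (s : SymmetryJet 𝓘(ℝ, E) M) (x : M) :
    IsSymmetricAt x (s.toFun x) :=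
  (s.isSemiHolonomic x).isSymmetricAt (s.src_toFun x) (s.p_toFun x)

end SymmetricJets

/-! ### Chain and product rules for vector-valued functions on manifolds. -/

section VectorValued

variable {E : Type*} [NormedAddCommGroup E] [NormedSpace ℝ E] {H : Type*} [TopologicalSpace H]
  {I : ModelWithCorners ℝ E H} {M : Type*} [TopologicalSpace M] [ChartedSpace H M]
  {E' : Type*} [NormedAddCommGroup E'] [NormedSpace ℝ E'] {H' : Type*} [TopologicalSpace H']
  {I' : ModelWithCorners ℝ E' H'} {M' : Type*} [TopologicalSpace M'] [ChartedSpace H' M']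
  {F : Type*} [NormedAddCommGroup F] [NormedSpace ℝ F]
  {G : Type*} [NormedAddCommGroup G] [NormedSpace ℝ G]

theorem mvfderiv_congr {f g : M → F} {x : M} (h : f =ᶠ[𝓝 x] g) :
    mvfderiv I f x = mvfderiv I g x :=
  h.mfderiv_eq (I := I) (I' := 𝓘(ℝ, F))

theorem mvfderiv_comp_mfderiv {g : M' → F} {f : M → M'} {x : M} {y : M'} (hy : f x = y)
    (hg : MDifferentiableAt I' 𝓘(ℝ, F) g y) (hf : MDifferentiableAt I I' f x)
    (v : TangentSpace I x) :
    mvfderiv I (g ∘ f) x v = mvfderiv I' g (f x) (mfderiv I I' f x v) := by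
  subst hy
  exact mfderiv_comp_apply x hg hf v

theorem mvfderiv_fderiv_comp {h : F → G} {g : M → F} {x : M} (hh : DifferentiableAt ℝ h (g x))
    (hg : MDifferentiableAt I 𝓘(ℝ, F) g x) (v : TangentSpace I x) :
    mvfderiv I (h ∘ g) x v = fderiv ℝ h (g x) (mvfderiv I g x v) := by
  have := mfderiv_comp_apply x hh.mdifferentiableAt hg v
  rw [mfderiv_eq_fderiv] at this
  exact this

theorem mvfderiv_prodMk {f : M → F} {g : M → G} {x : M} (hf : MDifferentiableAt I 𝓘(ℝ, F) f x)
    (hg : MDifferentiableAt I 𝓘(ℝ, G) g x) (v : TangentSpace I x) :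
    mvfderiv I (fun z ↦ (f z, g z)) x v = (mvfderiv I f x v, mvfderiv I g x v) := by
  have h : HasMFDerivAt I 𝓘(ℝ, F × G) (fun z ↦ (f z, g z)) x
      ((mvfderiv I f x).prod (mvfderiv I g x)) :=
    ⟨hf.hasMFDerivAt.1.prodMk hg.hasMFDerivAt.1, hf.hasMFDerivAt.2.prodMk hg.hasMFDerivAt.2⟩
  exact DFunLike.congr_fun h.mfderiv v

theorem mvfderiv_clm_apply {A : M → F →L[ℝ] G} {w : M → F} {x : M}
    (hA : MDifferentiableAt I 𝓘(ℝ, F →L[ℝ] G) A x) (hw : MDifferentiableAt I 𝓘(ℝ, F) w x)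
    (v : TangentSpace I x) :
    mvfderiv I (fun z ↦ A z (w z)) x v = mvfderiv I A x v (w x) + A x (mvfderiv I w x v) := by
  have h := isBoundedBilinearMap_apply (𝕜 := ℝ) (E := F) (F := G)
  refine (mvfderiv_fderiv_comp (g := fun z ↦ (A z, w z)) (h := fun p ↦ p.1 p.2)
    (h.differentiableAt _) (hA.prodMk_space hw) v).trans ?_
  rw [h.fderiv, mvfderiv_prodMk hA hw, IsBoundedBilinearMap.deriv_apply, add_comm]

end VectorValued

/-! ### The Lie bracket in a chart. -/

section Bracket

variable {E : Type*} [NormedAddCommGroup E] [NormedSpace ℝ E]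
  {M : Type*} [TopologicalSpace M] [ChartedSpace E M] [IsManifold 𝓘(ℝ, E) ∞ M]

theorem mfderiv_extChartAt_eq {x₀ z : M} (hz : z ∈ (chartAt E x₀).source) :
    mfderiv 𝓘(ℝ, E) 𝓘(ℝ, E) (extChartAt 𝓘(ℝ, E) x₀) z = tcoord (E := E) x₀ z := by
  rw [tcoord, TangentBundle.continuousLinearMapAt_trivializationAt hz]

theorem inverse_mfderiv_extChartAt {x₀ z : M} (hz : z ∈ (chartAt E x₀).source) :
    (mfderiv 𝓘(ℝ, E) 𝓘(ℝ, E) (extChartAt 𝓘(ℝ, E) x₀) z).inverse = tvec (E := E) x₀ z := by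
  rw [mfderiv_extChartAt_eq hz]
  refine ContinuousLinearMap.inverse_eq ?_ ?_
  · ext v
    exact tcoord_tvec hz v
  · ext v
    exact tvec_tcoord hz v

theorem mdifferentiableAt_section_coord {V : ∀ z : M, TangentSpace 𝓘(ℝ, E) z} {x₀ x : M}
    (hx : x ∈ (chartAt E x₀).source) :
    MDifferentiableAt 𝓘(ℝ, E) (𝓘(ℝ, E).prod 𝓘(ℝ, E))
      (fun z ↦ (⟨z, V z⟩ : TotalSpace E (TangentSpace 𝓘(ℝ, E) : M → Type _))) x ↔
    MDifferentiableAt 𝓘(ℝ, E) 𝓘(ℝ, E) (fun z ↦ tcoord x₀ z (V z)) x := by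
  refine (Trivialization.mdifferentiableAt_section_iff 𝓘(ℝ, E)
    (trivializationAt E (TangentSpace 𝓘(ℝ, E) : M → Type _) x₀) V hx).trans ?_
  refine Filter.EventuallyEq.mdifferentiableAt_iff ?_
  filter_upwards [(chartAt E x₀).open_source.mem_nhds hx] with z hz
  rw [tcoord, Trivialization.continuousLinearMapAt_apply, Trivialization.linearMapAt_apply, if_pos]
  exact hz

/-- A vector field, read in the preferred chart at `x₀`. -/
def inChart (x₀ : M) (V : ∀ z : M, TangentSpace 𝓘(ℝ, E) z) (u : E) : E :=
  tcoord x₀ ((extChartAt 𝓘(ℝ, E) x₀).symm u) (V ((extChartAt 𝓘(ℝ, E) x₀).symm u))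

theorem mpullback_inChart {x₀ z : M} (hz : z ∈ (chartAt E x₀).source)
    (V : ∀ z : M, TangentSpace 𝓘(ℝ, E) z) :
    VectorField.mpullback 𝓘(ℝ, E) 𝓘(ℝ, E) (extChartAt 𝓘(ℝ, E) x₀) (inChart (E := E) x₀ V) z =
      V z := by
  change (mfderiv 𝓘(ℝ, E) 𝓘(ℝ, E) (extChartAt 𝓘(ℝ, E) x₀) z).inverse
    (inChart (E := E) x₀ V (extChartAt 𝓘(ℝ, E) x₀ z)) = V z
  rw [inverse_mfderiv_extChartAt hz, inChart]
  rw [(extChartAt 𝓘(ℝ, E) x₀).left_inv (by simpa using hz)]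
  exact tvec_tcoord hz _

theorem differentiableAt_inChart {x₀ x : M} (hx : x ∈ (chartAt E x₀).source)
    {V : ∀ z : M, TangentSpace 𝓘(ℝ, E) z}
    (hV : MDifferentiableAt 𝓘(ℝ, E) (𝓘(ℝ, E).prod 𝓘(ℝ, E))
      (fun z ↦ (⟨z, V z⟩ : TotalSpace E (TangentSpace 𝓘(ℝ, E) : M → Type _))) x) :
    MDifferentiableAt 𝓘(ℝ, E) 𝓘(ℝ, E) (inChart x₀ V) (extChartAt 𝓘(ℝ, E) x₀ x) := by
  have h1 := (mdifferentiableAt_section_coord hx).1 hV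
  have h2 : MDifferentiableAt 𝓘(ℝ, E) 𝓘(ℝ, E) (extChartAt 𝓘(ℝ, E) x₀).symm
      (extChartAt 𝓘(ℝ, E) x₀ x) := by
    have := mdifferentiableWithinAt_extChartAt_symm (I := 𝓘(ℝ, E)) (x := x₀)
      ((extChartAt 𝓘(ℝ, E) x₀).map_source (x := x) (by simpa using hx))
    exact (this.mdifferentiableAt (by simp))
  refine MDifferentiableAt.comp (g := fun z ↦ tcoord x₀ z (V z)) _ ?_ h2
  rwa [(extChartAt 𝓘(ℝ, E) x₀).left_inv (by simpa using hx)]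

theorem mvfderiv_tcoord {x₀ x : M} (hx : x ∈ (chartAt E x₀).source)
    {V : ∀ z : M, TangentSpace 𝓘(ℝ, E) z}
    (hV : MDifferentiableAt 𝓘(ℝ, E) (𝓘(ℝ, E).prod 𝓘(ℝ, E))
      (fun z ↦ (⟨z, V z⟩ : TotalSpace E (TangentSpace 𝓘(ℝ, E) : M → Type _))) x)
    (v : TangentSpace 𝓘(ℝ, E) x) :
    mvfderiv 𝓘(ℝ, E) (fun z ↦ tcoord x₀ z (V z)) x v =
      fderiv ℝ (inChart x₀ V) (extChartAt 𝓘(ℝ, E) x₀ x) (tcoord x₀ x v) := by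
  have h1 : (fun z ↦ tcoord x₀ z (V z)) =ᶠ[𝓝 x] (inChart x₀ V) ∘ extChartAt 𝓘(ℝ, E) x₀ := by
    filter_upwards [(chartAt E x₀).open_source.mem_nhds hx] with z hz
    simp only [inChart, Function.comp]
    rw [(extChartAt 𝓘(ℝ, E) x₀).left_inv (by simpa using hz)]
  rw [mvfderiv_congr h1, mvfderiv_fderiv_comp
    (differentiableAt_inChart hx hV).differentiableAt (mdifferentiableAt_extChartAt hx),
    ← tcoord_eq_mvfderiv hx]

theorem mlieBracket_eq_fderiv (V W : ∀ u : E, TangentSpace 𝓘(ℝ, E) u) (u : E) :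
    VectorField.mlieBracket 𝓘(ℝ, E) V W u =
      fderiv ℝ (F := E) W u (V u) - fderiv ℝ (F := E) V u (W u) := by
  rw [← VectorField.mlieBracketWithin_univ]
  refine (congrFun (VectorField.mlieBracketWithin_eq_lieBracketWithin (𝕜 := ℝ) (V := V) (W := W)
    (s := Set.univ)) u).trans ?_
  exact congrFun (VectorField.lieBracketWithin_univ (𝕜 := ℝ) (E := E) (V := V) (W := W)) u

/-- Near `x` each field is the pullback by the chart of its coordinate expression. Brackets commute
with pullback, which reduces the claim to the bracket on `E`. -/
theorem tcoord_mlieBracket [CompleteSpace E] {x₀ x : M} (hx : x ∈ (chartAt E x₀).source)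
    {X V : ∀ z : M, TangentSpace 𝓘(ℝ, E) z}
    (hX : MDifferentiableAt 𝓘(ℝ, E) (𝓘(ℝ, E).prod 𝓘(ℝ, E))
      (fun z ↦ (⟨z, X z⟩ : TotalSpace E (TangentSpace 𝓘(ℝ, E) : M → Type _))) x)
    (hV : MDifferentiableAt 𝓘(ℝ, E) (𝓘(ℝ, E).prod 𝓘(ℝ, E))
      (fun z ↦ (⟨z, V z⟩ : TotalSpace E (TangentSpace 𝓘(ℝ, E) : M → Type _))) x) :
    tcoord x₀ x (VectorField.mlieBracket 𝓘(ℝ, E) X V x) =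
      mvfderiv 𝓘(ℝ, E) (fun z ↦ tcoord x₀ z (V z)) x (X x) -
      mvfderiv 𝓘(ℝ, E) (fun z ↦ tcoord x₀ z (X z)) x (V x) := by
  have : IsManifold 𝓘(ℝ, E) (minSmoothness ℝ 2) M := by
    rw [minSmoothness_of_isRCLikeNormedField]; infer_instance
  have hsec : ∀ {W : ∀ z : M, TangentSpace 𝓘(ℝ, E) z},
      MDifferentiableAt 𝓘(ℝ, E) (𝓘(ℝ, E).prod 𝓘(ℝ, E))
        (fun z ↦ (⟨z, W z⟩ : TotalSpace E (TangentSpace 𝓘(ℝ, E) : M → Type _))) x →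
      MDifferentiableAt 𝓘(ℝ, E) (𝓘(ℝ, E).prod 𝓘(ℝ, E))
        (fun u ↦ (⟨u, inChart (E := E) x₀ W u⟩ : TotalSpace E (TangentSpace 𝓘(ℝ, E) : E → Type _)))
        (extChartAt 𝓘(ℝ, E) x₀ x) := fun {W} hW ↦ by
    exact (mdifferentiableAt_section_coord (x₀ := extChartAt 𝓘(ℝ, E) x₀ x) (by simp)).2 (by
      simp only [tcoord, TangentBundle.continuousLinearMapAt_model_space]
      exact differentiableAt_inChart hx hW)
  have h1 : VectorField.mlieBracket 𝓘(ℝ, E) X V x = VectorField.mlieBracket 𝓘(ℝ, E)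
      (VectorField.mpullback 𝓘(ℝ, E) 𝓘(ℝ, E) (extChartAt 𝓘(ℝ, E) x₀) (inChart (E := E) x₀ X))
      (VectorField.mpullback 𝓘(ℝ, E) 𝓘(ℝ, E) (extChartAt 𝓘(ℝ, E) x₀)
        (inChart (E := E) x₀ V)) x := by
    refine (Filter.EventuallyEq.mlieBracket_vectorField_eq ?_ ?_).symm
    · filter_upwards [(chartAt E x₀).open_source.mem_nhds hx] with z hz using mpullback_inChart hz X
    · filter_upwards [(chartAt E x₀).open_source.mem_nhds hx] with z hz using mpullback_inChart hz V
  rw [h1, ← VectorField.mpullback_mlieBracket (n := ∞) (hsec hX) (hsec hV)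
    (contMDiffAt_extChartAt' hx)
      (by rw [minSmoothness_of_isRCLikeNormedField]; exact ENat.LEInfty.out),
    VectorField.mpullback_apply, inverse_mfderiv_extChartAt hx]
  refine (tcoord_tvec hx _).trans ?_
  refine (mlieBracket_eq_fderiv _ _ _).trans ?_
  rw [mvfderiv_tcoord hx hX, mvfderiv_tcoord hx hV]
  have hz : ∀ W : ∀ z : M, TangentSpace 𝓘(ℝ, E) z,
      inChart x₀ W (extChartAt 𝓘(ℝ, E) x₀ x) = tcoord x₀ x (W x) := by
    intro W
    rw [inChart, (extChartAt 𝓘(ℝ, E) x₀).left_inv (by simpa using hx)]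
  rw [hz, hz]

end Bracket

/-! ### The action of a bisection on vector fields, to first order. -/

section Action

variable {E : Type*} [NormedAddCommGroup E] [NormedSpace ℝ E]
  {M : Type*} [TopologicalSpace M] [ChartedSpace E M] [IsManifold 𝓘(ℝ, E) ∞ M]

theorem tcoord_cast {x₀ y y' : M} (h : y = y') (w : TangentSpace 𝓘(ℝ, E) y) :
    tcoord x₀ y' (h ▸ w) = tcoord x₀ y w := by
  subst h
  rfl

theorem tcoord_lin (x₀ : M) {x : M} (Y : ∀ z : M, TangentSpace 𝓘(ℝ, E) z)
    {ξ : Jet1 𝓘(ℝ, E) M 𝓘(ℝ, E) M} (h : ξ.src = x) (hx : x ∈ (chartAt E x₀).source) :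
    tcoord x₀ ξ.tgt (ξ.lin (Y ξ.src)) = jcoord x₀ ξ (tcoord x₀ x (Y x)) := by
  subst h
  change _ = tcoord x₀ ξ.tgt (ξ.lin (tvec x₀ ξ.src (tcoord x₀ ξ.src (Y ξ.src))))
  rw [tvec_tcoord hx]

theorem LocalBisection.tcoord_act {x₀ x y : M} (b : LocalBisection 𝓘(ℝ, E) x)
    (Y : ∀ z : M, TangentSpace 𝓘(ℝ, E) z) (hy : y ∈ b.base.target)
    (hz : b.base.toPartialEquiv.symm y ∈ (chartAt E x₀).source) :
    tcoord x₀ y (b.act Y y) =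
      jcoord x₀ (b.toFun (b.base.toPartialEquiv.symm y))
        (tcoord x₀ (b.base.toPartialEquiv.symm y) (Y (b.base.toPartialEquiv.symm y))) := by
  rw [LocalBisection.act, dif_pos hy, tcoord_cast]
  exact tcoord_lin x₀ Y (b.src_toFun _ (b.base.toPartialEquiv.map_target hy)) hz

theorem jcoord_negId {x₀ x : M} (hx : x ∈ (chartAt E x₀).source) :
    jcoord x₀ (negId 𝓘(ℝ, E) x) = -ContinuousLinearMap.id ℝ E := by
  ext v
  change tcoord x₀ x (-(tvec x₀ x v)) = -v
  rw [map_neg, tcoord_tvec hx]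

/-- If the jet of `b` is symmetric then so is the base map, to first order. -/
theorem LocalBisection.ofMap_base {x : M} {b : LocalBisection 𝓘(ℝ, E) x}
    (h : IsSymmetricAt x b.jet) : Jet1.ofMap 𝓘(ℝ, E) 𝓘(ℝ, E) b.base x = negId 𝓘(ℝ, E) x := by
  rw [← h.postcomp_tgt]
  refine Eq.trans ?_ (Jet1.postcomp_ofMap ((contMDiff_tgt (M := M) _).mdifferentiableAt (by simp))
    (b.contMDiffAt.mdifferentiableAt (by simp))).symm
  apply Jet1.ofMap_congr
  filter_upwards [b.base.open_source.mem_nhds b.mem_source] with z hz using (b.tgt_toFun z hz).symm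

theorem LocalBisection.base_apply {x : M} {b : LocalBisection 𝓘(ℝ, E) x}
    (h : IsSymmetricAt x b.jet) : b.base x = x :=
  congrArg Jet1.tgt (LocalBisection.ofMap_base h)

theorem LocalBisection.symm_apply {x : M} {b : LocalBisection 𝓘(ℝ, E) x}
    (h : IsSymmetricAt x b.jet) : b.base.toPartialEquiv.symm x = x :=
  (congrArg b.base.toPartialEquiv.symm (base_apply h)).symm.trans
    (b.base.toPartialEquiv.left_inv b.mem_source)

theorem LocalBisection.mem_target {x : M} {b : LocalBisection 𝓘(ℝ, E) x}
    (h : IsSymmetricAt x b.jet) : x ∈ b.base.target := by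
  have := b.base.toPartialEquiv.map_source b.mem_source
  rwa [show b.base.toPartialEquiv x = x from base_apply h] at this

theorem LocalBisection.contMDiffAt_symm {x : M} {b : LocalBisection 𝓘(ℝ, E) x}
    (h : IsSymmetricAt x b.jet) :
    ContMDiffAt 𝓘(ℝ, E) 𝓘(ℝ, E) ∞ b.base.toPartialEquiv.symm x :=
  b.base.contMDiffOn_invFun.contMDiffAt (b.base.open_target.mem_nhds (mem_target h))

theorem LocalBisection.mfderiv_symm {x : M} {b : LocalBisection 𝓘(ℝ, E) x}
    (h : IsSymmetricAt x b.jet) (v : E) :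
    mfderiv 𝓘(ℝ, E) 𝓘(ℝ, E) b.base.toPartialEquiv.symm x v = -v := by
  -- The derivatives of `b.base` at `symm x` and at `x` have different types; both are read as
  -- endomorphisms of `E` so that they can be equated.
  have e := congrArg (fun z ↦ (show E →L[ℝ] E from mfderiv 𝓘(ℝ, E) 𝓘(ℝ, E) b.base z)) (symm_apply h)
  have h0 := congrArg (fun ξ : Jet1 𝓘(ℝ, E) M 𝓘(ℝ, E) M ↦ (show E →L[ℝ] E from ξ.lin))
    (ofMap_base h)
  have h1 : mfderiv 𝓘(ℝ, E) 𝓘(ℝ, E) b.base x = -ContinuousLinearMap.id ℝ E := h0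
  have h2 : b.base ∘ b.base.toPartialEquiv.symm =ᶠ[𝓝 x] id := by
    filter_upwards [b.base.open_target.mem_nhds (mem_target h)] with y hy
    exact b.base.toPartialEquiv.right_inv hy
  have h3 := h2.mfderiv_eq (I := 𝓘(ℝ, E)) (I' := 𝓘(ℝ, E))
  have hb : MDifferentiableAt 𝓘(ℝ, E) 𝓘(ℝ, E) b.base x :=
    (b.base.contMDiffOn_toFun.contMDiffAt (b.base.open_source.mem_nhds
      b.mem_source)).mdifferentiableAt (by simp)
  rw [mfderiv_comp_of_eq hb ((contMDiffAt_symm h).mdifferentiableAt (by simp)) (symm_apply h),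
    mfderiv_id] at h3
  have h4 := DFunLike.congr_fun h3 v
  have h5 : mfderiv 𝓘(ℝ, E) 𝓘(ℝ, E) b.base x
      (mfderiv 𝓘(ℝ, E) 𝓘(ℝ, E) b.base.toPartialEquiv.symm x v) = v :=
    (congrArg (fun A : E →L[ℝ] E ↦
      A (mfderiv 𝓘(ℝ, E) 𝓘(ℝ, E) b.base.toPartialEquiv.symm x v)) e).symm.trans h4
  rw [h1] at h5
  exact neg_eq_iff_eq_neg.1 h5

theorem LocalBisection.tcoord_act_eventuallyEq {x₀ x : M} {b : LocalBisection 𝓘(ℝ, E) x}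
    (hx : x ∈ (chartAt E x₀).source) (h : IsSymmetricAt x b.jet)
    (Y : ∀ z : M, TangentSpace 𝓘(ℝ, E) z) :
    (fun y ↦ tcoord x₀ y (b.act Y y)) =ᶠ[𝓝 x]
      (fun z ↦ jcoord x₀ (b.toFun z) (tcoord x₀ z (Y z))) ∘ b.base.toPartialEquiv.symm := by
  have hc := (contMDiffAt_symm h).continuousAt.preimage_mem_nhds
    ((chartAt E x₀).open_source.mem_nhds (by rwa [symm_apply h]))
  filter_upwards [b.base.open_target.mem_nhds (mem_target h), hc] with y hy hz
  exact b.tcoord_act Y hy hz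

theorem LocalBisection.contMDiffAt_jcoord {x₀ x : M} {b : LocalBisection 𝓘(ℝ, E) x}
    (hx : x ∈ (chartAt E x₀).source) (h : IsSymmetricAt x b.jet) :
    ContMDiffAt 𝓘(ℝ, E) 𝓘(ℝ, E →L[ℝ] E) ∞ (fun z ↦ jcoord x₀ (b.toFun z)) x := by
  have h0 : b.toFun x = negId 𝓘(ℝ, E) x := h.tgt_eq
  exact ((contMDiffAt_jet_iff (by rwa [h0]) (by rwa [h0])).1 b.contMDiffAt).2.2

theorem LocalBisection.mdifferentiableAt_act {x₀ x : M} {b : LocalBisection 𝓘(ℝ, E) x}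
    (hx : x ∈ (chartAt E x₀).source) (h : IsSymmetricAt x b.jet)
    {Y : ∀ z : M, TangentSpace 𝓘(ℝ, E) z}
    (hY : MDifferentiableAt 𝓘(ℝ, E) 𝓘(ℝ, E) (fun z ↦ tcoord x₀ z (Y z)) x) :
    MDifferentiableAt 𝓘(ℝ, E) 𝓘(ℝ, E) (fun y ↦ tcoord x₀ y (b.act Y y)) x := by
  refine ((tcoord_act_eventuallyEq hx h Y).mdifferentiableAt_iff).2 ?_
  refine MDifferentiableAt.comp (I' := 𝓘(ℝ, E)) x ?_
    ((contMDiffAt_symm h).mdifferentiableAt (by simp))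
  rw [symm_apply h]
  exact ((contMDiffAt_jcoord hx h).mdifferentiableAt (by simp)).clm_apply hY

/-- Product rule for `(A Y) ∘ f⁻¹`, where `A x = -I` and `D f⁻¹ = -I` at `x`: the two signs cancel
on the derivative of `Y`, while the derivative of `A` keeps one. -/
theorem LocalBisection.mvfderiv_act {x₀ x : M} {b : LocalBisection 𝓘(ℝ, E) x}
    (hx : x ∈ (chartAt E x₀).source) (h : IsSymmetricAt x b.jet)
    {Y : ∀ z : M, TangentSpace 𝓘(ℝ, E) z}
    (hY : MDifferentiableAt 𝓘(ℝ, E) 𝓘(ℝ, E) (fun z ↦ tcoord x₀ z (Y z)) x)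
    (v : TangentSpace 𝓘(ℝ, E) x) :
    mvfderiv 𝓘(ℝ, E) (fun y ↦ tcoord x₀ y (b.act Y y)) x v =
      mvfderiv 𝓘(ℝ, E) (fun z ↦ tcoord x₀ z (Y z)) x v -
        gam x₀ b.jet (tcoord x₀ x v) (tcoord x₀ x (Y x)) := by
  have h0 : b.toFun x = negId 𝓘(ℝ, E) x := h.tgt_eq
  have hc := (contMDiffAt_jcoord hx h).mdifferentiableAt (n := ∞) (by simp)
  have hg := gam_ofMap (x₀ := x₀) (b.contMDiffAt.mdifferentiableAt (by simp)) (by rwa [h0])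
    (by rwa [h0]) (tcoord x₀ x v)
  rw [tvec_tcoord hx] at hg
  rw [mvfderiv_congr (tcoord_act_eventuallyEq hx h Y),
    mvfderiv_comp_mfderiv (I' := 𝓘(ℝ, E)) (symm_apply h)
    (hc.clm_apply hY) ((contMDiffAt_symm h).mdifferentiableAt (by simp)), symm_apply h]
  refine (congrArg (mvfderiv 𝓘(ℝ, E) _ x) (mfderiv_symm h v)).trans ?_
  refine (mvfderiv_clm_apply hc hY _).trans ?_
  rw [h0, jcoord_negId hx, LocalBisection.jet, hg]
  have e1 : mvfderiv 𝓘(ℝ, E) (fun z ↦ jcoord x₀ (b.toFun z)) x (-v) =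
    - mvfderiv 𝓘(ℝ, E) (fun z ↦ jcoord x₀ (b.toFun z)) x v := map_neg _ v
  have e2 : mvfderiv 𝓘(ℝ, E) (fun z ↦ tcoord x₀ z (Y z)) x (-v) =
    - mvfderiv 𝓘(ℝ, E) (fun z ↦ tcoord x₀ z (Y z)) x v := map_neg _ v
  refine (congrArg₂ (fun (A : E →L[ℝ] E) (w : E) ↦
    A (tcoord x₀ x (Y x)) + (-ContinuousLinearMap.id ℝ E) w) e1 e2).trans ?_
  simp only [neg_apply, ContinuousLinearMap.id_apply, neg_neg]
  abel

theorem LocalBisection.act_self {x₀ x : M} {b : LocalBisection 𝓘(ℝ, E) x}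
    (hx : x ∈ (chartAt E x₀).source) (h : IsSymmetricAt x b.jet)
    (Y : ∀ z : M, TangentSpace 𝓘(ℝ, E) z) : b.act Y x = - Y x := by
  have h0 : b.toFun x = negId 𝓘(ℝ, E) x := h.tgt_eq
  have := (tcoord_act_eventuallyEq hx h Y).eq_of_nhds
  rw [Function.comp_apply, symm_apply h, h0, jcoord_negId hx] at this
  rw [← tvec_tcoord hx (b.act Y x), this]
  change tvec x₀ x (-(tcoord x₀ x (Y x))) = _
  rw [map_neg, tvec_tcoord hx]

/-- Since `b(Y) = -Y` at `x`, the field `Y + b(Y)` vanishes there and the bracket loses its term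
with the derivative of `X`. What remains sees `b` only through its jet. -/
theorem tcoord_mlieBracket_act [CompleteSpace E] {x₀ x : M} {b : LocalBisection 𝓘(ℝ, E) x}
    (hx : x ∈ (chartAt E x₀).source) (h : IsSymmetricAt x b.jet)
    (X Y : VField 𝓘(ℝ, E) M) :
    tcoord x₀ x ((1 / 2 : ℝ) • VectorField.mlieBracket 𝓘(ℝ, E) X (fun y ↦ Y y + b.act Y y) x) =
      mvfderiv 𝓘(ℝ, E) (fun z ↦ tcoord x₀ z (Y z)) x (X x) -
        (1 / 2 : ℝ) • gam x₀ b.jet (tcoord x₀ x (X x)) (tcoord x₀ x (Y x)) := by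
  have hX := (X.contMDiff x).mdifferentiableAt (by simp)
  have hY' := (Y.contMDiff x).mdifferentiableAt (by simp)
  have hY := (mdifferentiableAt_section_coord hx).1 hY'
  have hb := LocalBisection.mdifferentiableAt_act hx h hY
  have hadd : (fun z ↦ tcoord x₀ z (Y z + b.act Y z)) =
      (fun z ↦ tcoord x₀ z (Y z)) + fun z ↦ tcoord x₀ z (b.act Y z) := by
    ext z
    exact map_add _ _ _
  have hV : MDifferentiableAt 𝓘(ℝ, E) 𝓘(ℝ, E) (fun z ↦ tcoord x₀ z (Y z + b.act Y z)) x := by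
    rw [hadd]
    exact hY.add hb
  rw [map_smul, tcoord_mlieBracket hx hX ((mdifferentiableAt_section_coord hx).2 hV), hadd,
    mvfderiv_add hY hb, LocalBisection.act_self hx h, add_neg_cancel, map_zero, sub_zero,
    add_apply, LocalBisection.mvfderiv_act hx h hY]
  module

end Action

/-! ### Local bisections from the inverse function theorem. -/

section InverseFunction

variable {E : Type*} [NormedAddCommGroup E] [NormedSpace ℝ E]

theorem isOpen_setOf_isInvertible [CompleteSpace E] :
    IsOpen {A : E →L[ℝ] E | A.IsInvertible} :=
  ContinuousLinearEquiv.isOpen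

/-- The inverse function theorem for smooth maps, with a smooth inverse. -/
theorem exists_openPartialHomeomorph [CompleteSpace E] {g : E → E} {S : Set E} {a : E}
    (hS : IsOpen S) (ha : a ∈ S) (hg : ContDiffOn ℝ ∞ g S) (hinv : (fderiv ℝ g a).IsInvertible) :
    ∃ e : OpenPartialHomeomorph E E, a ∈ e.source ∧ e.source ⊆ S ∧ (e : E → E) = g ∧
      ContDiffOn ℝ ∞ e.symm e.target := by
  have hga : ContDiffAt ℝ ∞ g a := hg.contDiffAt (hS.mem_nhds ha)
  obtain ⟨f', hf'⟩ := hinv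
  have hstrict : HasStrictFDerivAt g (f' : E →L[ℝ] E) a := by
    rw [hf']
    exact hga.hasStrictFDerivAt (by simp)
  let e₀ := hstrict.toOpenPartialHomeomorph g
  -- Restricting to points where the derivative is invertible makes the inverse smooth on its whole
  -- domain, not only at `g a`.
  have hcont : ContinuousOn (fderiv ℝ g) S := hg.continuousOn_fderiv_of_isOpen hS (by simp)
  have hU : IsOpen (S ∩ fderiv ℝ g ⁻¹' {A : E →L[ℝ] E | A.IsInvertible}) :=
    hcont.isOpen_inter_preimage hS isOpen_setOf_isInvertible
  refine ⟨e₀.restrOpen _ hU, ?_, ?_, rfl, ?_⟩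
  · rw [e₀.restrOpen_source]
    exact ⟨hstrict.mem_toOpenPartialHomeomorph_source, ha, ⟨f', hf'⟩⟩
  · rw [e₀.restrOpen_source]
    exact fun u hu ↦ hu.2.1
  · intro b hb
    have hs := (e₀.restrOpen _ hU).map_target hb
    rw [e₀.restrOpen_source] at hs
    obtain ⟨-, hs, A, hA⟩ := hs
    have hd : ContDiffAt ℝ ∞ g ((e₀.restrOpen _ hU).symm b) := hg.contDiffAt (hS.mem_nhds hs)
    refine ((e₀.restrOpen _ hU).contDiffAt_symm (f₀' := A) hb ?_ hd).contDiffWithinAt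
    rw [hA]
    exact (hd.differentiableAt (by simp)).hasFDerivAt

variable {M : Type*} [TopologicalSpace M] [ChartedSpace E M]

theorem isInvertible_neg_id : (-ContinuousLinearMap.id ℝ E).IsInvertible :=
  .of_inverse (g := -ContinuousLinearMap.id ℝ E) (by ext; simp) (by ext; simp)

theorem isInvertible_mfderiv_of_ofMap_eq_negId {f : M → M} {x : M}
    (h : Jet1.ofMap 𝓘(ℝ, E) 𝓘(ℝ, E) f x = negId 𝓘(ℝ, E) x) :
    (mfderiv 𝓘(ℝ, E) 𝓘(ℝ, E) f x).IsInvertible := by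
  have h' : mfderiv 𝓘(ℝ, E) 𝓘(ℝ, E) f x = -ContinuousLinearMap.id ℝ E :=
    congrArg (fun ξ : Jet1 𝓘(ℝ, E) M 𝓘(ℝ, E) M ↦ (show E →L[ℝ] E from ξ.lin)) h
  have := isInvertible_neg_id (E := E)
  rw [← h'] at this
  exact this

variable [IsManifold 𝓘(ℝ, E) ∞ M]

/-- The preferred chart at `x` as a diffeomorphism onto an open subset of the model space. -/
def chartDiffeo (x : M) : PartialDiffeomorph 𝓘(ℝ, E) 𝓘(ℝ, E) M E ∞ where
  toPartialEquiv := (chartAt E x).toPartialEquiv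
  open_source := (chartAt E x).open_source
  open_target := (chartAt E x).open_target
  contMDiffOn_toFun := contMDiffOn_chart
  contMDiffOn_invFun := contMDiffOn_chart_symm

theorem exists_partialDiffeomorph [CompleteSpace E] {f : M → M} {W : Set M} {x : M}
    (hW : IsOpen W) (hx : x ∈ W) (hf : ContMDiffOn 𝓘(ℝ, E) 𝓘(ℝ, E) ∞ f W)
    (hinv : (mfderiv 𝓘(ℝ, E) 𝓘(ℝ, E) f x).IsInvertible) :
    ∃ Φ : PartialDiffeomorph 𝓘(ℝ, E) 𝓘(ℝ, E) M M ∞, x ∈ Φ.source ∧ Φ.source ⊆ W ∧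
      ∀ z ∈ Φ.source, Φ z = f z := by
  let φ := chartAt E x
  let ψ := chartAt E (f x)
  let g : E → E := ψ ∘ f ∘ φ.symm
  have hV : IsOpen (W ∩ f ⁻¹' ψ.source) := hf.continuousOn.isOpen_inter_preimage hW ψ.open_source
  let S : Set E := φ.target ∩ φ.symm ⁻¹' (W ∩ f ⁻¹' ψ.source)
  have hS : IsOpen S := φ.isOpen_inter_preimage_symm hV
  have hxφ : x ∈ φ.source := mem_chart_source E x
  have ha : φ x ∈ S := by
    refine ⟨φ.map_source hxφ, ?_⟩
    rw [Set.mem_preimage, φ.left_inv hxφ]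
    exact ⟨hx, mem_chart_source E (f x)⟩
  have hg : ContDiffOn ℝ ∞ g S := by
    rw [← contMDiffOn_iff_contDiffOn]
    refine (contMDiffOn_chart (x := f x)).comp (t := ψ.source) ?_ fun u hu ↦ hu.2.2
    exact hf.comp ((contMDiffOn_chart_symm (x := x)).mono fun u hu ↦ hu.1) fun u hu ↦ hu.2.1
  have hfx : MDifferentiableAt 𝓘(ℝ, E) 𝓘(ℝ, E) f x :=
    (hf.contMDiffAt (hW.mem_nhds hx)).mdifferentiableAt (by simp)
  have hinv' : (fderiv ℝ g (φ x)).IsInvertible := by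
    have h : mfderiv 𝓘(ℝ, E) 𝓘(ℝ, E) f x = fderiv ℝ g (φ x) := by
      rw [hfx.mfderiv, modelWithCornersSelf_coe, Set.range_id, fderivWithin_univ]
      rfl
    rwa [h] at hinv
  obtain ⟨e, hae, heS, heg, hes⟩ := exists_openPartialHomeomorph hS ha hg hinv'
  let e' : PartialDiffeomorph 𝓘(ℝ, E) 𝓘(ℝ, E) E E ∞ :=
    { toPartialEquiv := e.toPartialEquiv
      open_source := e.open_source
      open_target := e.open_target
      contMDiffOn_toFun := by
        change ContMDiffOn _ _ _ e e.source
        rw [heg, contMDiffOn_iff_contDiffOn]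
        exact hg.mono heS
      contMDiffOn_invFun := contMDiffOn_iff_contDiffOn.2 hes }
  have he' : ∀ u, e' u = g u := fun u ↦ congrFun heg u
  refine ⟨((chartDiffeo x).trans e').trans (chartDiffeo (f x)).symm, ?_, ?_, ?_⟩
  · refine ⟨⟨hxφ, hae⟩, ?_⟩
    change e' (φ x) ∈ ψ.target
    rw [he']
    refine ψ.map_source ?_
    rw [Function.comp_apply, φ.left_inv hxφ]
    exact mem_chart_source E (f x)
  · rintro z ⟨⟨hz, hz'⟩, -⟩
    have := (heS hz').2.1
    change φ.symm (φ z) ∈ W at this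
    rwa [φ.left_inv hz] at this
  · rintro z ⟨⟨hz, hz'⟩, -⟩
    change ψ.symm (e' (φ z)) = f z
    have h3 : f (φ.symm (φ z)) ∈ ψ.source := (heS hz').2.2
    rw [he', show g (φ z) = ψ (f (φ.symm (φ z))) from rfl, ψ.left_inv h3, φ.left_inv hz]

theorem ofCoord_neg_id {x₀ x : M} (hx : x ∈ (chartAt E x₀).source) :
    ofCoord x₀ ((x, x), -ContinuousLinearMap.id ℝ E) = negId 𝓘(ℝ, E) x := by
  refine congrArg (Jet1.mk x x) ?_
  ext v
  change tvec x₀ x (-(tcoord x₀ x v)) = -v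
  rw [map_neg, tvec_tcoord hx]

theorem isInvertible_tcoord {x₀ z : M} (hz : z ∈ (chartAt E x₀).source) :
    (tcoord (E := E) x₀ z).IsInvertible :=
  .of_inverse (g := tvec x₀ z) (by ext v; exact tcoord_tvec hz v)
    (by ext v; exact tvec_tcoord hz v)

theorem isInvertible_tvec {x₀ z : M} (hz : z ∈ (chartAt E x₀).source) :
    (tvec (E := E) x₀ z).IsInvertible :=
  .of_inverse (g := tcoord x₀ z) (by ext v; exact tvec_tcoord hz v)
    (by ext v; exact tcoord_tvec hz v)

theorem isInvertible_lin_of_jcoord {x₀ : M} {ξ : Jet1 𝓘(ℝ, E) M 𝓘(ℝ, E) M}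
    (h₁ : ξ.src ∈ (chartAt E x₀).source) (h₂ : ξ.tgt ∈ (chartAt E x₀).source)
    (h : (jcoord x₀ ξ).IsInvertible) : ξ.lin.IsInvertible := by
  have : ξ.lin = (tvec x₀ ξ.tgt).comp ((jcoord x₀ ξ).comp (tcoord x₀ ξ.src)) := by
    ext v
    change ξ.lin v =
      tvec x₀ ξ.tgt (tcoord x₀ ξ.tgt (ξ.lin (tvec x₀ ξ.src (tcoord x₀ ξ.src v))))
    rw [tvec_tcoord h₂, tvec_tcoord h₁]
  rw [this]
  exact (isInvertible_tvec h₂).comp (h.comp (isInvertible_tcoord h₁))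

/-- A smooth section of the source map through `-I_x` whose target map is `-I` to first order at
`x` is a local bisection near `x`. -/
theorem exists_localBisection [CompleteSpace E] {g : M → Jet1 𝓘(ℝ, E) M 𝓘(ℝ, E) M} {W : Set M}
    {x : M} (hW : IsOpen W) (hx : x ∈ W)
    (hg : ContMDiffOn 𝓘(ℝ, E) (jetModel 𝓘(ℝ, E) 𝓘(ℝ, E)) ∞ g W) (hs : ∀ z, (g z).src = z)
    (h0 : g x = negId 𝓘(ℝ, E) x)
    (ht : Jet1.ofMap 𝓘(ℝ, E) 𝓘(ℝ, E) (fun z ↦ (g z).tgt) x = negId 𝓘(ℝ, E) x) :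
    ∃ b : LocalBisection 𝓘(ℝ, E) x, b.toFun = g := by
  have hxc : x ∈ (chartAt E x).source := mem_chart_source E x
  have htg : ContMDiffOn 𝓘(ℝ, E) 𝓘(ℝ, E) ∞ (fun z ↦ (g z).tgt) W :=
    contMDiff_tgt.comp_contMDiffOn hg
  -- On `W₁` both ends of the jets stay in one chart, so invertibility of the linear part can be
  -- tested on `jcoord`; there it is the open condition defining `W₂`.
  let W₁ : Set M := (W ∩ (chartAt E x).source) ∩ (fun z ↦ (g z).tgt) ⁻¹' (chartAt E x).source
  have hW₁ : IsOpen W₁ := (htg.continuousOn.mono Set.inter_subset_left).isOpen_inter_preimage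
    (hW.inter (chartAt E x).open_source) (chartAt E x).open_source
  have hxW₁ : x ∈ W₁ := ⟨⟨hx, hxc⟩, by rw [Set.mem_preimage, h0]; exact hxc⟩
  have hjc : ContinuousOn (fun z ↦ jcoord x (g z)) W₁ := fun z hz ↦
    ((contMDiffAt_jet_iff (x₀ := x) (by rw [hs]; exact hz.1.2) hz.2).1
      (hg.contMDiffAt (hW.mem_nhds hz.1.1))).2.2.continuousAt.continuousWithinAt
  let W₂ : Set M := W₁ ∩ (fun z ↦ jcoord x (g z)) ⁻¹' {A : E →L[ℝ] E | A.IsInvertible}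
  have hW₂ : IsOpen W₂ := hjc.isOpen_inter_preimage hW₁ isOpen_setOf_isInvertible
  have hxW₂ : x ∈ W₂ := by
    refine ⟨hxW₁, ?_⟩
    change (jcoord x (g x)).IsInvertible
    rw [h0, jcoord_negId hxc]
    exact isInvertible_neg_id
  have hinv : (mfderiv 𝓘(ℝ, E) 𝓘(ℝ, E) (fun z ↦ (g z).tgt) x).IsInvertible :=
    isInvertible_mfderiv_of_ofMap_eq_negId ht
  obtain ⟨Φ, hxΦ, hΦW, hΦ⟩ := exists_partialDiffeomorph hW₂ hxW₂
    (htg.mono fun z hz ↦ hz.1.1.1) hinv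
  exact ⟨{
    toFun := g
    base := Φ
    mem_source := hxΦ
    contMDiffOn_toFun := hg.mono fun z hz ↦ (hΦW hz).1.1.1
    src_toFun := fun z _ ↦ hs z
    tgt_toFun := fun z hz ↦ (hΦ z hz).symm
    isInvertible_lin := fun z hz ↦ isInvertible_lin_of_jcoord (x₀ := x)
      (by rw [hs]; exact (hΦW hz).1.1.2) (hΦW hz).1.2 (hΦW hz).2 }, rfl⟩

end InverseFunction

/-! ### Realizing a symmetric jet with prescribed second order part. -/

section Germ

variable {E : Type*} [NormedAddCommGroup E] [NormedSpace ℝ E]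
  {M : Type*} [TopologicalSpace M] [ChartedSpace E M]

variable {x₀ x : M}

theorem two_smul_sub_self (u : E) : (2 : ℝ) • u - u = u := by
  rw [two_smul, add_sub_cancel_right]

/-- The open set on which `symGerm x₀ Γ x` is smooth. -/
def symGermDomain (x₀ x : M) : Set M :=
  (extChartAt 𝓘(ℝ, E) x₀).source ∩ extChartAt 𝓘(ℝ, E) x₀ ⁻¹'
    ((fun u ↦ (2 : ℝ) • extChartAt 𝓘(ℝ, E) x₀ x - u) ⁻¹' (extChartAt 𝓘(ℝ, E) x₀).target)

theorem isOpen_symGermDomain : IsOpen (symGermDomain (E := E) x₀ x) :=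
  (continuousOn_extChartAt x₀).isOpen_inter_preimage (isOpen_extChartAt_source x₀)
    ((isOpen_extChartAt_target x₀).preimage (by fun_prop))

theorem mem_symGermDomain (hx : x ∈ (chartAt E x₀).source) : x ∈ symGermDomain (E := E) x₀ x := by
  have hx' : x ∈ (extChartAt 𝓘(ℝ, E) x₀).source := by simpa using hx
  refine ⟨hx', ?_⟩
  simp only [Set.mem_preimage, two_smul_sub_self]
  exact (extChartAt 𝓘(ℝ, E) x₀).map_source hx'

theorem Jet1.mk_eq_negId {y : M} (hy : y = x)
    {L : TangentSpace 𝓘(ℝ, E) x →L[ℝ] TangentSpace 𝓘(ℝ, E) y}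
    (hL : ∀ v : TangentSpace 𝓘(ℝ, E) x, L v = (-v : TangentSpace 𝓘(ℝ, E) x)) :
    Jet1.mk x y L = negId 𝓘(ℝ, E) x := by
  subst hy
  refine congrArg (Jet1.mk y y) ?_
  ext v
  exact hL v

variable [IsManifold 𝓘(ℝ, E) ∞ M]

/-- A section of the source map through `-I_x` over the point reflection in the preferred chart
at `x₀`, with first order part `Γ`. -/
def symGerm (x₀ : M) (Γ : E →L[ℝ] E →L[ℝ] E) (x z : M) : Jet1 𝓘(ℝ, E) M 𝓘(ℝ, E) M :=
  ofCoord x₀ ((z, (extChartAt 𝓘(ℝ, E) x₀).symm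
      ((2 : ℝ) • extChartAt 𝓘(ℝ, E) x₀ x - extChartAt 𝓘(ℝ, E) x₀ z)),
    -ContinuousLinearMap.id ℝ E + Γ (extChartAt 𝓘(ℝ, E) x₀ z - extChartAt 𝓘(ℝ, E) x₀ x))

/-- Smoothness is needed jointly in the base point and the variable, so that the derivative in the
variable depends smoothly on the base point. -/
theorem contMDiffAt_symGerm {Γ : M → E →L[ℝ] E →L[ℝ] E} {p : M × M}
    (hΓ : ContMDiffAt 𝓘(ℝ, E) 𝓘(ℝ, E →L[ℝ] E →L[ℝ] E) ∞ Γ p.1)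
    (h₁ : p.1 ∈ (chartAt E x₀).source) (h₂ : p.2 ∈ (chartAt E x₀).source)
    (h : (2 : ℝ) • extChartAt 𝓘(ℝ, E) x₀ p.1 - extChartAt 𝓘(ℝ, E) x₀ p.2 ∈
      (extChartAt 𝓘(ℝ, E) x₀).target) :
    ContMDiffAt (𝓘(ℝ, E).prod 𝓘(ℝ, E)) (jetModel 𝓘(ℝ, E) 𝓘(ℝ, E)) ∞
      (fun q : M × M ↦ symGerm x₀ (Γ q.1) q.1 q.2) p := by
  have c₁ : ContMDiffAt (𝓘(ℝ, E).prod 𝓘(ℝ, E)) 𝓘(ℝ, E) ∞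
      (fun q : M × M ↦ extChartAt 𝓘(ℝ, E) x₀ q.1) p :=
    (contMDiffAt_extChartAt' h₁).comp p contMDiffAt_fst
  have c₂ : ContMDiffAt (𝓘(ℝ, E).prod 𝓘(ℝ, E)) 𝓘(ℝ, E) ∞
      (fun q : M × M ↦ extChartAt 𝓘(ℝ, E) x₀ q.2) p :=
    (contMDiffAt_extChartAt' h₂).comp p contMDiffAt_snd
  have c₃ : ContMDiffAt (𝓘(ℝ, E).prod 𝓘(ℝ, E)) 𝓘(ℝ, E) ∞
      (fun q : M × M ↦ (extChartAt 𝓘(ℝ, E) x₀).symm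
        ((2 : ℝ) • extChartAt 𝓘(ℝ, E) x₀ q.1 - extChartAt 𝓘(ℝ, E) x₀ q.2)) p :=
    ((contMDiffOn_extChartAt_symm x₀).contMDiffAt
      ((isOpen_extChartAt_target x₀).mem_nhds h)).comp p
        (((contMDiffAt_const (I' := 𝓘(ℝ, ℝ))).smul c₁).sub c₂)
  have c₄ : ContMDiffAt (𝓘(ℝ, E).prod 𝓘(ℝ, E)) 𝓘(ℝ, E →L[ℝ] E) ∞
      (fun q : M × M ↦ -ContinuousLinearMap.id ℝ E +
        Γ q.1 (extChartAt 𝓘(ℝ, E) x₀ q.2 - extChartAt 𝓘(ℝ, E) x₀ q.1)) p :=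
    contMDiffAt_const.add ((hΓ.comp p contMDiffAt_fst).clm_apply (c₂.sub c₁))
  refine (contMDiffAt_ofCoord h₂ ?_).comp p ((contMDiffAt_snd.prodMk c₃).prodMk c₄)
  simpa using (extChartAt 𝓘(ℝ, E) x₀).map_target h

theorem contMDiffOn_symGerm (Γ : E →L[ℝ] E →L[ℝ] E) (hx : x ∈ (chartAt E x₀).source) :
    ContMDiffOn 𝓘(ℝ, E) (jetModel 𝓘(ℝ, E) 𝓘(ℝ, E)) ∞ (symGerm x₀ Γ x)
      (symGermDomain (E := E) x₀ x) := by
  intro z hz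
  have := (contMDiffAt_symGerm (Γ := fun _ ↦ Γ) (p := (x, z)) contMDiffAt_const hx
    (by simpa using hz.1) hz.2).comp z (contMDiffAt_const.prodMk contMDiffAt_id)
  exact this.contMDiffWithinAt

theorem symGerm_self (Γ : E →L[ℝ] E →L[ℝ] E) (hx : x ∈ (chartAt E x₀).source) :
    symGerm x₀ Γ x x = negId 𝓘(ℝ, E) x := by
  rw [symGerm, two_smul_sub_self, (extChartAt 𝓘(ℝ, E) x₀).left_inv (by simpa using hx), sub_self,
    map_zero, add_zero, ofCoord_neg_id hx]

theorem contMDiffAt_symGerm_self (Γ : E →L[ℝ] E →L[ℝ] E) (hx : x ∈ (chartAt E x₀).source) :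
    ContMDiffAt 𝓘(ℝ, E) (jetModel 𝓘(ℝ, E) 𝓘(ℝ, E)) ∞ (symGerm x₀ Γ x) x :=
  (contMDiffOn_symGerm Γ hx).contMDiffAt (isOpen_symGermDomain.mem_nhds (mem_symGermDomain hx))

theorem ofMap_eq_negId {q : M → M} (hx : x ∈ (chartAt E x₀).source) (hqx : q x = x)
    (hq : MDifferentiableAt 𝓘(ℝ, E) 𝓘(ℝ, E) q x)
    (h : ∀ v, mvfderiv 𝓘(ℝ, E) (extChartAt 𝓘(ℝ, E) x₀ ∘ q) x v = -tcoord x₀ x v) :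
    Jet1.ofMap 𝓘(ℝ, E) 𝓘(ℝ, E) q x = negId 𝓘(ℝ, E) x := by
  refine Jet1.mk_eq_negId hqx fun v ↦ ?_
  have h1 := h v
  rw [mvfderiv_comp_mfderiv (I' := 𝓘(ℝ, E)) hqx (mdifferentiableAt_extChartAt hx) hq, hqx,
    ← tcoord_eq_mvfderiv hx,
    ← map_neg] at h1
  have h2 := congrArg (tvec x₀ x) h1
  rw [tvec_tcoord hx] at h2
  exact h2.trans (tvec_tcoord hx _)

theorem ofMap_tgt_symGerm (Γ : E →L[ℝ] E →L[ℝ] E) (hx : x ∈ (chartAt E x₀).source) :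
    Jet1.ofMap 𝓘(ℝ, E) 𝓘(ℝ, E) (fun z ↦ (symGerm x₀ Γ x z).tgt) x = negId 𝓘(ℝ, E) x := by
  refine ofMap_eq_negId hx (by rw [symGerm_self Γ hx]; rfl)
    ((contMDiff_tgt.contMDiffAt.comp x (contMDiffAt_symGerm_self Γ hx)).mdifferentiableAt
      (by simp)) fun v ↦ ?_
  have h : extChartAt 𝓘(ℝ, E) x₀ ∘ (fun z ↦ (symGerm x₀ Γ x z).tgt) =ᶠ[𝓝 x]
      (fun u ↦ (2 : ℝ) • extChartAt 𝓘(ℝ, E) x₀ x - u) ∘ extChartAt 𝓘(ℝ, E) x₀ := by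
    filter_upwards [isOpen_symGermDomain.mem_nhds (mem_symGermDomain hx)] with z hz
    exact (extChartAt 𝓘(ℝ, E) x₀).right_inv hz.2
  rw [mvfderiv_congr h, mvfderiv_fderiv_comp (by fun_prop) (mdifferentiableAt_extChartAt hx),
    ← tcoord_eq_mvfderiv hx, fderiv_const_sub, fderiv_fun_id]
  rfl

/-- The symmetric jet at `x` with second order part `Γ` in the preferred chart at `x₀`. -/
def symJet (x₀ : M) (Γ : E →L[ℝ] E →L[ℝ] E) (x : M) : Jet11 𝓘(ℝ, E) M :=
  Jet1.ofMap 𝓘(ℝ, E) (jetModel 𝓘(ℝ, E) 𝓘(ℝ, E)) (symGerm x₀ Γ x) x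

theorem isSymmetricAt_symJet (Γ : E →L[ℝ] E →L[ℝ] E) (hx : x ∈ (chartAt E x₀).source) :
    IsSymmetricAt x (symJet x₀ Γ x) :=
  isSymmetricAt_ofMap ((contMDiffAt_symGerm_self Γ hx).mdifferentiableAt (by simp))
    (symGerm_self Γ hx) (Filter.Eventually.of_forall fun _ ↦ rfl) (ofMap_tgt_symGerm Γ hx)

theorem gam_symJet (Γ : E →L[ℝ] E →L[ℝ] E) (hx : x ∈ (chartAt E x₀).source) :
    gam x₀ (symJet x₀ Γ x) = Γ := by
  ext1 v
  have h0 := symGerm_self Γ hx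
  refine (gam_ofMap ((contMDiffAt_symGerm_self Γ hx).mdifferentiableAt (by simp))
    (by rwa [h0]) (by rwa [h0]) v).trans ?_
  have h : (fun z ↦ jcoord x₀ (symGerm x₀ Γ x z)) =ᶠ[𝓝 x]
      (fun u ↦ -ContinuousLinearMap.id ℝ E + Γ (u - extChartAt 𝓘(ℝ, E) x₀ x)) ∘
        extChartAt 𝓘(ℝ, E) x₀ := by
    filter_upwards [isOpen_symGermDomain.mem_nhds (mem_symGermDomain hx)] with z hz
    refine jcoord_ofCoord (by simpa using hz.1) ?_
    simpa using (extChartAt 𝓘(ℝ, E) x₀).map_target hz.2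
  rw [mvfderiv_congr h, mvfderiv_fderiv_comp (by fun_prop) (mdifferentiableAt_extChartAt hx),
    ← tcoord_eq_mvfderiv hx, tcoord_tvec hx, fderiv_const_add]
  have : fderiv ℝ (fun u ↦ Γ (u - extChartAt 𝓘(ℝ, E) x₀ x)) (extChartAt 𝓘(ℝ, E) x₀ x) = Γ := by
    rw [fderiv_comp_sub]
    exact Γ.fderiv
  rw [this]

theorem exists_localBisection_symJet [CompleteSpace E] (Γ : E →L[ℝ] E →L[ℝ] E)
    (hx : x ∈ (chartAt E x₀).source) :
    ∃ b : LocalBisection 𝓘(ℝ, E) x, b.jet = symJet x₀ Γ x := by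
  obtain ⟨b, hb⟩ := exists_localBisection isOpen_symGermDomain (mem_symGermDomain hx)
    (contMDiffOn_symGerm Γ hx) (fun _ ↦ rfl) (symGerm_self Γ hx) (ofMap_tgt_symGerm Γ hx)
  exact ⟨b, by rw [LocalBisection.jet, hb]; rfl⟩

/-- The jet equals the explicit `symJet` with the same second order part, and that one comes from a
bisection. -/
theorem IsSymmetricAt.exists_localBisection [CompleteSpace E] {θ : Jet11 𝓘(ℝ, E) M}
    (h : IsSymmetricAt x θ) : ∃ b : LocalBisection 𝓘(ℝ, E) x, b.jet = θ := by
  have hx := mem_chart_source E x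
  obtain ⟨b, hb⟩ := exists_localBisection_symJet (gam x θ) hx
  refine ⟨b, hb.trans ?_⟩
  exact (isSymmetricAt_symJet (gam x θ) hx).eq_of_gam_eq hx h (gam_symJet _ hx)

end Germ

/-! ### Smooth dependence between a symmetric jet and its second order part. -/

section Smooth

variable {E : Type*} [NormedAddCommGroup E] [NormedSpace ℝ E]
  {M : Type*} [TopologicalSpace M] [ChartedSpace E M] [IsManifold 𝓘(ℝ, E) ∞ M]

theorem contMDiffAt_symGerm_diag {x₀ : M} {Γ : M → E →L[ℝ] E →L[ℝ] E}
    (hΓ : ContMDiffAt 𝓘(ℝ, E) 𝓘(ℝ, E →L[ℝ] E →L[ℝ] E) ∞ Γ x₀) :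
    ContMDiffAt (𝓘(ℝ, E).prod 𝓘(ℝ, E)) (jetModel 𝓘(ℝ, E) 𝓘(ℝ, E)) ∞
      (fun q : M × M ↦ symGerm x₀ (Γ q.1) q.1 q.2) (x₀, x₀) := by
  have hx := mem_chart_source E x₀
  exact contMDiffAt_symGerm hΓ hx hx (mem_symGermDomain hx).2

theorem contMDiffAt_symJet {x₀ : M} {Γ : M → E →L[ℝ] E →L[ℝ] E}
    (hΓ : ContMDiffAt 𝓘(ℝ, E) 𝓘(ℝ, E →L[ℝ] E →L[ℝ] E) ∞ Γ x₀) :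
    ContMDiffAt 𝓘(ℝ, E) (jet11Model 𝓘(ℝ, E)) ∞ (fun x ↦ symJet x₀ (Γ x) x) x₀ := by
  have h := contMDiffAt_symGerm_diag hΓ
  refine (contMDiffAt_jet_iff_inCoordinates (x₀ := x₀) (y₀ := symGerm x₀ (Γ x₀) x₀ x₀)
    (mem_chart_source E x₀) (mem_chart_source _ _)).2 ⟨contMDiffAt_id, ?_, ?_⟩
  · have hd : ContMDiffAt 𝓘(ℝ, E) (𝓘(ℝ, E).prod 𝓘(ℝ, E)) ∞ (fun x : M ↦ (x, x)) x₀ :=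
      contMDiffAt_id.prodMk contMDiffAt_id
    exact ContMDiffAt.comp (f := fun x : M ↦ (x, x)) x₀ h hd
  -- The linear part is a partial derivative of the jointly smooth germ, taken along the diagonal.
  · exact ContMDiffAt.mfderiv (fun x z ↦ symGerm x₀ (Γ x) x z) id h contMDiffAt_id (by simp)

theorem contMDiffAt_gam {x₀ : M} {s : M → Jet11 𝓘(ℝ, E) M}
    (hs : ContMDiffAt 𝓘(ℝ, E) (jet11Model 𝓘(ℝ, E)) ∞ s x₀)
    (h₁ : (s x₀).src = x₀) (h₂ : (s x₀).tgt = negId 𝓘(ℝ, E) x₀) :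
    ContMDiffAt 𝓘(ℝ, E) 𝓘(ℝ, E →L[ℝ] E →L[ℝ] E) ∞ (fun x ↦ gam x₀ (s x)) x₀ := by
  obtain ⟨hsrc, htgt, hlin⟩ := (contMDiffAt_jet_iff_inCoordinates (x₀ := x₀)
    (y₀ := (s x₀).tgt) (by rw [h₁]; exact mem_chart_source E x₀) (mem_chart_source _ _)).1 hs
  have hj : ContMDiffAt (jetModel 𝓘(ℝ, E) 𝓘(ℝ, E)) 𝓘(ℝ, E →L[ℝ] E) ∞ (jcoord x₀) (s x₀).tgt := by
    rw [h₂]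
    exact contMDiffAt_jcoord (mem_chart_source E x₀) (mem_chart_source E x₀)
  have hd := (hj.mfderiv_const (m := ∞) (by simp)).comp x₀ htgt
  refine (hd.clm_comp hlin).congr_of_eventuallyEq ?_
  filter_upwards [htgt.continuousAt.preimage_mem_nhds
    ((chartAt (JetH E E E E) (s x₀).tgt).open_source.mem_nhds (mem_chart_source _ _))] with x hx
  ext1 v
  let e := trivializationAt ((E × E) × (E →L[ℝ] E))
    (TangentSpace (jetModel 𝓘(ℝ, E) 𝓘(ℝ, E)) : Jet1 𝓘(ℝ, E) M 𝓘(ℝ, E) M → Type _) (s x₀).tgt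
  -- Composing the two coordinate expressions inserts a trivialization of the tangent bundle of
  -- `J¹(M, M)` followed by its inverse; they cancel near `x₀`.
  have hw : ∀ w, e.symmL ℝ (s x).tgt (e.continuousLinearMapAt ℝ (s x).tgt w) = w :=
    e.symmL_continuousLinearMapAt hx
  have hm : ∀ a b w, (trivializationAt (E →L[ℝ] E) (TangentSpace 𝓘(ℝ, E →L[ℝ] E) :
      (E →L[ℝ] E) → Type _) a).continuousLinearMapAt ℝ b w = w := fun a b w ↦ by
    rw [TangentBundle.continuousLinearMapAt_model_space]
    rfl
  refine Eq.symm ((hm _ _ _).trans ?_)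
  exact congrArg (mfderiv (jetModel 𝓘(ℝ, E) 𝓘(ℝ, E)) 𝓘(ℝ, E →L[ℝ] E) (jcoord x₀) (s x).tgt)
    (hw _)

end Smooth

/-! ### The connection of a symmetry jet. -/

section Connection

variable {E : Type*} [NormedAddCommGroup E] [NormedSpace ℝ E]
  {M : Type*} [TopologicalSpace M] [ChartedSpace E M] [IsManifold 𝓘(ℝ, E) ∞ M]

theorem tcoord_injective {x₀ x : M} (hx : x ∈ (chartAt E x₀).source) :
    Function.Injective (tcoord (E := E) x₀ x) :=
  Function.LeftInverse.injective (tvec_tcoord hx)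

/-- The coordinates of a vector field in the preferred chart at `x₀`. -/
def VField.coord (x₀ : M) (Y : VField 𝓘(ℝ, E) M) (z : M) : E := tcoord x₀ z (Y z)

theorem VField.contMDiffAt_coord {x₀ x : M} (Y : VField 𝓘(ℝ, E) M)
    (hx : x ∈ (chartAt E x₀).source) : ContMDiffAt 𝓘(ℝ, E) 𝓘(ℝ, E) ∞ (Y.coord x₀) x :=
  (contMDiffAt_section_coord hx).1 (Y.contMDiff x)

theorem VField.mdifferentiableAt_coord {x₀ x : M} (Y : VField 𝓘(ℝ, E) M)
    (hx : x ∈ (chartAt E x₀).source) : MDifferentiableAt 𝓘(ℝ, E) 𝓘(ℝ, E) (Y.coord x₀) x :=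
  (Y.contMDiffAt_coord hx).mdifferentiableAt (by simp)

theorem VField.coord_add (x₀ : M) (Y Z : VField 𝓘(ℝ, E) M) :
    (Y + Z).coord x₀ = Y.coord x₀ + Z.coord x₀ := by
  ext z
  exact map_add (tcoord x₀ z) (Y z) (Z z)

theorem VField.coord_smul (x₀ : M) (c : ℝ) (Y : VField 𝓘(ℝ, E) M) :
    (c • Y).coord x₀ = c • Y.coord x₀ := by
  ext z
  exact map_smul (tcoord x₀ z) c (Y z)

theorem VField.coord_smulField (x₀ : M) (f : C^∞⟮𝓘(ℝ, E), M; ℝ⟯) (Y : VField 𝓘(ℝ, E) M) :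
    (smulField f Y).coord x₀ = (f : M → ℝ) • Y.coord x₀ := by
  ext z
  exact map_smul (tcoord x₀ z) (f z) (Y z)

theorem VField.contMDiffAt_mvfderiv_coord (X Y : VField 𝓘(ℝ, E) M) (x₀ : M) :
    ContMDiffAt 𝓘(ℝ, E) 𝓘(ℝ, E) ∞ (fun z ↦ mvfderiv 𝓘(ℝ, E) (Y.coord x₀) z (X z)) x₀ := by
  have hx := mem_chart_source E x₀
  have h : (fun z ↦ mvfderiv 𝓘(ℝ, E) (Y.coord x₀) z (X z)) =ᶠ[𝓝 x₀]
      fun z ↦ fderiv ℝ (inChart x₀ Y) (extChartAt 𝓘(ℝ, E) x₀ z) (X.coord x₀ z) := by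
    filter_upwards [(chartAt E x₀).open_source.mem_nhds hx] with z hz
    exact mvfderiv_tcoord hz ((Y.contMDiff z).mdifferentiableAt (by simp)) (X z)
  refine ContMDiffAt.congr_of_eventuallyEq ?_ h
  have hY : ContDiffAt ℝ ∞ (inChart x₀ Y) (extChartAt 𝓘(ℝ, E) x₀ x₀) := by
    rw [← contMDiffAt_iff_contDiffAt]
    refine ContMDiffAt.comp (I' := 𝓘(ℝ, E)) (g := Y.coord x₀) _ ?_
      ((contMDiffOn_extChartAt_symm x₀).contMDiffAt
        ((isOpen_extChartAt_target x₀).mem_nhds (mem_extChartAt_target x₀)))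
    rw [extChartAt_to_inv]
    exact Y.contMDiffAt_coord hx
  have hd : ContDiffAt ℝ ∞ (fderiv ℝ (inChart x₀ Y)) (extChartAt 𝓘(ℝ, E) x₀ x₀) :=
    hY.fderiv_right (by simp)
  exact (hd.contMDiffAt.comp x₀ contMDiffAt_extChartAt).clm_apply (X.contMDiffAt_coord hx)

theorem VField.ext_coord {Y Z : VField 𝓘(ℝ, E) M} (h : ∀ x, Y.coord x x = Z.coord x x) : Y = Z := by
  ext x
  exact tcoord_injective (mem_chart_source E x) (h x)

theorem smulField_apply (f : C^∞⟮𝓘(ℝ, E), M; ℝ⟯) (X : VField 𝓘(ℝ, E) M) (x : M) :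
    smulField f X x = f x • X x := rfl

theorem VField.sum_apply {ι : Type*} (t : Finset ι) (X : ι → VField 𝓘(ℝ, E) M) (x : M) :
    (∑ i ∈ t, X i) x = ∑ i ∈ t, X i x := by
  rw [← ContMDiffSection.coeAddHom_apply, map_sum, Finset.sum_apply]
  rfl

theorem SymmetryJet.contMDiffAt_gam (s : SymmetryJet 𝓘(ℝ, E) M) (x₀ : M) :
    ContMDiffAt 𝓘(ℝ, E) 𝓘(ℝ, E →L[ℝ] E →L[ℝ] E) ∞ (fun x ↦ gam x₀ (s.toFun x)) x₀ :=
  SymJet.contMDiffAt_gam (s.contMDiff_toFun x₀) (s.isSymmetricAt x₀).src_eq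
    (s.isSymmetricAt x₀).tgt_eq

/-- `∇_X Y` at `x`, given by the second order part `gam x₀ (s x)` in the chart at `x₀`. -/
def chartNabla (x₀ : M) (Γ : E →L[ℝ] E →L[ℝ] E) (X Y : VField 𝓘(ℝ, E) M) (x : M) : E :=
  mvfderiv 𝓘(ℝ, E) (Y.coord x₀) x (X x) - (1 / 2 : ℝ) • Γ (X.coord x₀ x) (Y.coord x₀ x)

variable [CompleteSpace E]

/-- The vector field `∇_X Y` associated with a symmetry jet. -/
def SymmetryJet.nabla (s : SymmetryJet 𝓘(ℝ, E) M) (X Y : VField 𝓘(ℝ, E) M) (x : M) :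
    TangentSpace 𝓘(ℝ, E) x :=
  (1 / 2 : ℝ) • VectorField.mlieBracket 𝓘(ℝ, E) X
    (fun y ↦ Y y + (s.isSymmetricAt x).exists_localBisection.choose.act Y y) x

theorem tcoord_mlieBracket_act_eq {x₀ x : M} (hx : x ∈ (chartAt E x₀).source)
    {θ : Jet11 𝓘(ℝ, E) M} (h : IsSymmetricAt x θ) (b : LocalBisection 𝓘(ℝ, E) x) (hb : b.jet = θ)
    (X Y : VField 𝓘(ℝ, E) M) :
    tcoord x₀ x ((1 / 2 : ℝ) • VectorField.mlieBracket 𝓘(ℝ, E) X (fun y ↦ Y y + b.act Y y) x) =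
      chartNabla x₀ (gam x₀ θ) X Y x := by
  subst hb
  exact tcoord_mlieBracket_act hx h X Y

theorem SymmetryJet.tcoord_nabla (s : SymmetryJet 𝓘(ℝ, E) M) {x₀ x : M}
    (hx : x ∈ (chartAt E x₀).source) (X Y : VField 𝓘(ℝ, E) M) :
    tcoord x₀ x (s.nabla X Y x) = chartNabla x₀ (gam x₀ (s.toFun x)) X Y x :=
  tcoord_mlieBracket_act_eq hx (s.isSymmetricAt x) _
    (s.isSymmetricAt x).exists_localBisection.choose_spec X Y

/-- Independence of the bisection chosen in `nabla`: the coordinate formula involves only the jet.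
-/
theorem SymmetryJet.nabla_eq_mlieBracket (s : SymmetryJet 𝓘(ℝ, E) M) {x : M}
    (b : LocalBisection 𝓘(ℝ, E) x) (hb : b.jet = s.toFun x) (X Y : VField 𝓘(ℝ, E) M) :
    s.nabla X Y x =
      (1 / 2 : ℝ) • VectorField.mlieBracket 𝓘(ℝ, E) X (fun y ↦ Y y + b.act Y y) x := by
  have hx := mem_chart_source E x
  apply tcoord_injective hx
  rw [s.tcoord_nabla hx, tcoord_mlieBracket_act_eq hx (s.isSymmetricAt x) b hb]

/-- `∇_X Y` as a smooth vector field. -/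
def SymmetryJet.nablaField (s : SymmetryJet 𝓘(ℝ, E) M) (X Y : VField 𝓘(ℝ, E) M) :
    VField 𝓘(ℝ, E) M where
  toFun := s.nabla X Y
  contMDiff_toFun x₀ := by
    have hx := mem_chart_source E x₀
    refine (contMDiffAt_section_coord hx).2 ?_
    have h : (fun z ↦ tcoord x₀ z (s.nabla X Y z)) =ᶠ[𝓝 x₀]
        fun z ↦ chartNabla x₀ (gam x₀ (s.toFun z)) X Y z := by
      filter_upwards [(chartAt E x₀).open_source.mem_nhds hx] with z hz
      exact s.tcoord_nabla hz X Y
    refine ContMDiffAt.congr_of_eventuallyEq ?_ h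
    refine (X.contMDiffAt_mvfderiv_coord Y x₀).sub ?_
    refine (contMDiffAt_const (I' := 𝓘(ℝ, ℝ))).smul ?_
    exact ((s.contMDiffAt_gam x₀).clm_apply (X.contMDiffAt_coord hx)).clm_apply
      (Y.contMDiffAt_coord hx)

theorem SymmetryJet.coord_nablaField (s : SymmetryJet 𝓘(ℝ, E) M) (X Y : VField 𝓘(ℝ, E) M) (x : M) :
    (s.nablaField X Y).coord x x = chartNabla x (gam x (s.toFun x)) X Y x :=
  s.tcoord_nabla (mem_chart_source E x) X Y

/-- The affine connection associated with a symmetry jet. -/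
def SymmetryJet.connection (s : SymmetryJet 𝓘(ℝ, E) M) : AffineConnection 𝓘(ℝ, E) M where
  toFun := LinearMap.mk₂ ℝ s.nablaField
    (fun X X' Y ↦ VField.ext_coord fun x ↦ by
      rw [VField.coord_add, Pi.add_apply]
      simp only [coord_nablaField, chartNabla, VField.coord_add, Pi.add_apply,
        ContMDiffSection.coe_add, map_add, add_apply, smul_add]
      abel)
    (fun c X Y ↦ VField.ext_coord fun x ↦ by
      rw [VField.coord_smul, Pi.smul_apply]
      simp only [coord_nablaField, chartNabla, VField.coord_smul, Pi.smul_apply,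
        ContMDiffSection.coe_smul, map_smul, smul_apply, smul_sub]
      rw [smul_comm c])
    (fun X Y Y' ↦ VField.ext_coord fun x ↦ by
      have hx := mem_chart_source E x
      rw [VField.coord_add, Pi.add_apply]
      simp only [coord_nablaField, chartNabla, VField.coord_add,
        mvfderiv_add (Y.mdifferentiableAt_coord hx) (Y'.mdifferentiableAt_coord hx), Pi.add_apply,
        map_add, add_apply, smul_add]
      abel)
    (fun c X Y ↦ VField.ext_coord fun x ↦ by
      have hx := mem_chart_source E x
      rw [VField.coord_smul, Pi.smul_apply]
      have : mvfderiv 𝓘(ℝ, E) (c • Y.coord x) x (X x) = c • mvfderiv 𝓘(ℝ, E) (Y.coord x) x (X x) :=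
        congrArg (fun A : E →L[ℝ] E ↦ A (X x)) (const_smul_mfderiv (Y.mdifferentiableAt_coord hx) c)
      simp only [coord_nablaField, chartNabla, VField.coord_smul, this, Pi.smul_apply, map_smul,
        smul_sub]
      rw [smul_comm c])
  smul_left f X Y := VField.ext_coord fun x ↦ by
    rw [VField.coord_smulField, Pi.smul_apply']
    simp only [LinearMap.mk₂_apply, coord_nablaField, chartNabla, VField.coord_smulField,
      Pi.smul_apply', map_smul, smul_apply, smul_sub]
    have : mvfderiv 𝓘(ℝ, E) (Y.coord x) x (smulField f X x) =
      f x • mvfderiv 𝓘(ℝ, E) (Y.coord x) x (X x) := map_smul _ (f x) (X x)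
    rw [this, smul_comm (f x) (1 / 2 : ℝ)]
  leibniz f X Y x := by
    have hx := mem_chart_source E x
    apply tcoord_injective hx
    rw [map_add, map_smul, map_smul]
    refine (s.coord_nablaField X (smulField f Y) x).trans ?_
    have h := s.coord_nablaField X Y x
    change tcoord x x (s.nablaField X Y x) = _ at h
    rw [LinearMap.mk₂_apply, h]
    simp only [chartNabla, VField.coord_smulField]
    rw [mvfderiv_smul (f.contMDiff.contMDiffAt.mdifferentiableAt (by simp))
      (Y.mdifferentiableAt_coord hx)]
    simp only [Pi.smul_apply', map_smul, add_apply, smul_apply, ContinuousLinearMap.smulRight_apply,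
      smul_sub, smul_comm (f x) (1 / 2 : ℝ)]
    change _ = _ • Y.coord x x + _
    abel

end Connection

/-! ### Global vector fields with prescribed local behaviour. -/

section Frame

variable {E : Type*} [NormedAddCommGroup E] [NormedSpace ℝ E] [FiniteDimensional ℝ E]
  {M : Type*} [TopologicalSpace M] [ChartedSpace E M]

/-- In finite dimension `A` is a fixed linear expression in its values on a basis. -/
theorem contMDiffAt_clm_of_apply {F : Type*} [NormedAddCommGroup F] [NormedSpace ℝ F]
    {A : M → E →L[ℝ] F} {x : M} (h : ∀ e, ContMDiffAt 𝓘(ℝ, E) 𝓘(ℝ, F) ∞ (fun z ↦ A z e) x) :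
    ContMDiffAt 𝓘(ℝ, E) 𝓘(ℝ, E →L[ℝ] F) ∞ A x := by
  let b := Module.finBasis ℝ E
  have hA : A = fun z ↦ ∑ i, ContinuousLinearMap.smulRightL ℝ E F
      (LinearMap.toContinuousLinearMap (b.coord i)) (A z (b i)) := by
    ext z v
    refine (congrArg (A z) (b.sum_repr v).symm).trans ?_
    rw [map_sum]
    simp
  rw [hA]
  refine ContMDiffAt.sum fun i _ ↦ ?_
  exact (ContinuousLinearMap.contMDiff _).contMDiffAt.comp x (h (b i))

/-- A smooth function with support in the domain of the chart at `x₀`, equal to `1` near `x₀`. -/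
def bump (x₀ : M) : SmoothBumpFunction 𝓘(ℝ, E) x₀ := Classical.arbitrary _

theorem bump_eq_zero {x₀ z : M} (hz : z ∉ (chartAt E x₀).source) : bump (E := E) x₀ z = 0 := by
  by_contra h
  exact hz ((bump x₀).support_subset_source h)

variable [IsManifold 𝓘(ℝ, E) ∞ M] [T2Space M]

/-- `bump x₀` as a smooth function. -/
def bumpMap (x₀ : M) : C^∞⟮𝓘(ℝ, E), M; ℝ⟯ := ⟨bump (E := E) x₀, (bump x₀).contMDiff⟩

/-- The constant vector field `e` in the chart at `x₀`, multiplied by `bump x₀`. -/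
def frame (x₀ : M) : E →ₗ[ℝ] VField 𝓘(ℝ, E) M where
  toFun e :=
    { toFun := fun z ↦ bump (E := E) x₀ z • tvec x₀ z e
      contMDiff_toFun := fun z ↦ by
        by_cases hz : z ∈ (chartAt E x₀).source
        · refine (contMDiffAt_section_coord hz).2 ?_
          have h : (fun z ↦ tcoord x₀ z (bump (E := E) x₀ z • tvec x₀ z e)) =ᶠ[𝓝 z]
              fun z ↦ bump (E := E) x₀ z • e := by
            filter_upwards [(chartAt E x₀).open_source.mem_nhds hz] with y hy
            rw [map_smul, tcoord_tvec hy]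
          exact ((bump x₀).contMDiffAt.smul contMDiffAt_const).congr_of_eventuallyEq h
        · have hz' : z ∉ tsupport (bump (E := E) x₀) := fun h ↦
            hz ((bump x₀).tsupport_subset_chartAt_source h)
          refine (contMDiffAt_section_coord (mem_chart_source E z)).2 ?_
          have h : (fun y ↦ tcoord z y (bump (E := E) x₀ y • tvec x₀ y e)) =ᶠ[𝓝 z]
              fun _ ↦ (0 : E) := by
            filter_upwards [notMem_tsupport_iff_eventuallyEq.1 hz'] with y hy
            rw [hy, Pi.zero_apply, zero_smul, map_zero]
          exact contMDiffAt_const.congr_of_eventuallyEq h }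
  map_add' e e' := by
    ext z
    change bump (E := E) x₀ z • tvec x₀ z (e + e') =
      bump (E := E) x₀ z • tvec x₀ z e + bump (E := E) x₀ z • tvec x₀ z e'
    rw [map_add, smul_add]
  map_smul' c e := by
    ext z
    change bump (E := E) x₀ z • tvec x₀ z (c • e) = c • bump (E := E) x₀ z • tvec x₀ z e
    rw [map_smul, smul_comm]

theorem frame_apply (x₀ z : M) (e : E) : frame x₀ e z = bump (E := E) x₀ z • tvec x₀ z e := rfl

theorem exists_vField_coord {x₀ x : M} (hx : x ∈ (chartAt E x₀).source) (e : E) :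
    ∃ X : VField 𝓘(ℝ, E) M, X.coord x₀ x = e := by
  -- The frame is centred at `x`, where its bump function is `1`; `bump x₀` may vanish at `x`.
  refine ⟨frame x (tcoord x x (tvec x₀ x e)), ?_⟩
  rw [VField.coord, frame_apply, bump, SmoothBumpFunction.eq_one, one_smul,
    tvec_tcoord (mem_chart_source E x), tcoord_tvec hx]

/-- The derivative terms coincide, and global fields take arbitrary values at `x`. -/
theorem gam_eq_of_chartNabla_eq {x₀ x : M} (hx : x ∈ (chartAt E x₀).source)
    {Γ Γ' : E →L[ℝ] E →L[ℝ] E}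
    (h : ∀ X Y : VField 𝓘(ℝ, E) M, chartNabla x₀ Γ X Y x = chartNabla x₀ Γ' X Y x) : Γ = Γ' := by
  ext u v
  obtain ⟨X, rfl⟩ := exists_vField_coord hx u
  obtain ⟨Y, rfl⟩ := exists_vField_coord hx v
  have := sub_right_injective (h X Y)
  exact (smul_right_injective E (by norm_num : (1 / 2 : ℝ) ≠ 0)) this

/-- The components of a vector field in the chart at `x₀`, multiplied by `bump x₀`. -/
def bumpComponent (x₀ : M) (X : VField 𝓘(ℝ, E) M) (i : Fin (Module.finrank ℝ E)) :
    C^∞⟮𝓘(ℝ, E), M; ℝ⟯ :=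
  ⟨fun z ↦ bump (E := E) x₀ z • (Module.finBasis ℝ E).coord i (X.coord x₀ z),
    (bump x₀).contMDiff_smul fun z hz ↦
      ((LinearMap.toContinuousLinearMap
        ((Module.finBasis ℝ E).coord i)).contMDiff.contMDiffAt.comp z
        (X.contMDiffAt_coord hz)).contMDiffWithinAt⟩

theorem bumpComponent_apply (x₀ : M) (X : VField 𝓘(ℝ, E) M) (i : Fin (Module.finrank ℝ E)) (z : M) :
    bumpComponent x₀ X i z =
      bump (E := E) x₀ z • (Module.finBasis ℝ E).coord i (X.coord x₀ z) := rfl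

/-- The bump function is squared so that the components and the frame each absorb one factor and
become global. The axioms of a connection, stated for global objects, then apply to a local
expansion. -/
theorem bump_smul_bump_smul (x₀ : M) (X : VField 𝓘(ℝ, E) M) :
    smulField (bumpMap x₀) (smulField (bumpMap x₀) X) =
      ∑ i, smulField (bumpComponent x₀ X i) (frame x₀ (Module.finBasis ℝ E i)) := by
  ext z
  rw [VField.sum_apply]
  change bump (E := E) x₀ z • bump (E := E) x₀ z • X z = _
  by_cases hz : z ∈ (chartAt E x₀).source
  · simp only [smulField_apply, frame_apply, bumpComponent_apply, smul_assoc,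
      smul_comm _ (bump (E := E) x₀ z),
      ← Finset.smul_sum]
    congr 2
    apply tcoord_injective hz
    simp only [map_sum, map_smul, tcoord_tvec hz]
    exact ((Module.finBasis ℝ E).sum_repr (X.coord x₀ z)).symm
  · simp only [smulField_apply, frame_apply, bump_eq_zero hz, zero_smul, smul_zero,
      Finset.sum_const_zero]

end Frame

/-! ### Christoffel symbols and the inverse construction. -/

section Christoffel

variable {E : Type*} [NormedAddCommGroup E] [NormedSpace ℝ E] [FiniteDimensional ℝ E]
  {M : Type*} [TopologicalSpace M] [ChartedSpace E M] [IsManifold 𝓘(ℝ, E) ∞ M] [T2Space M]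
  (D : AffineConnection 𝓘(ℝ, E) M)

/-- `C^∞`-linearity is applied to `bump_smul_bump_smul` and evaluated where the bump function is
`1`, giving dependence on the value of `X` at `x` alone. -/
theorem AffineConnection.left_eq_frame {x₀ x : M}
    (hb : bump (E := E) x₀ x = 1) (X Y : VField 𝓘(ℝ, E) M) :
    D.toFun X Y x = D.toFun (frame x₀ (X.coord x₀ x)) Y x := by
  have h := congrArg (fun Z ↦ D.toFun Z Y x) (bump_smul_bump_smul x₀ X)
  simp only [map_sum, LinearMap.sum_apply, VField.sum_apply, D.smul_left] at h
  change bump (E := E) x₀ x • bump (E := E) x₀ x • D.toFun X Y x =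
    ∑ i, bumpComponent x₀ X i x • D.toFun (frame x₀ (Module.finBasis ℝ E i)) Y x at h
  simp only [hb, one_smul, bumpComponent_apply] at h
  rw [h]
  conv_rhs => rw [← (Module.finBasis ℝ E).sum_repr (X.coord x₀ x)]
  simp only [map_sum, map_smul, LinearMap.sum_apply, LinearMap.smul_apply, VField.sum_apply]
  rfl

/-- Here the bump function must be `1` near `x`, not just at `x`, because the Leibniz rule
differentiates it. -/
theorem AffineConnection.toFun_right_eq {x₀ x : M} (hx : x ∈ (chartAt E x₀).source)
    (hb : bump (E := E) x₀ =ᶠ[𝓝 x] 1) (X Y : VField 𝓘(ℝ, E) M) :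
    tcoord x₀ x (D.toFun X Y x) = mvfderiv 𝓘(ℝ, E) (Y.coord x₀) x (X x) +
      tcoord x₀ x (D.toFun X (frame x₀ (Y.coord x₀ x)) x) := by
  have hb1 : bump (E := E) x₀ x = 1 := hb.eq_of_nhds
  have hd : mvfderiv 𝓘(ℝ, E) (bumpMap (E := E) x₀) x (X x) = 0 := by
    have : (bumpMap (E := E) x₀ : M → ℝ) =ᶠ[𝓝 x] fun _ ↦ 1 := hb
    rw [mvfderiv_congr this, mvfderiv_const]
    rfl
  have h := congrArg (fun Z ↦ D.toFun X Z x) (bump_smul_bump_smul x₀ Y)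
  have hc : ∀ i, mvfderiv 𝓘(ℝ, E) (bumpComponent x₀ Y i) x (X x) =
      (Module.finBasis ℝ E).repr (mvfderiv 𝓘(ℝ, E) (Y.coord x₀) x (X x)) i := by
    intro i
    have : (bumpComponent x₀ Y i : M → ℝ) =ᶠ[𝓝 x]
        (LinearMap.toContinuousLinearMap ((Module.finBasis ℝ E).coord i)) ∘ Y.coord x₀ := by
      filter_upwards [hb] with z hz
      rw [bumpComponent_apply, hz, Pi.one_apply, one_smul]
      rfl
    rw [mvfderiv_congr this, mvfderiv_fderiv_comp (ContinuousLinearMap.differentiableAt _)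
      (Y.mdifferentiableAt_coord hx), ContinuousLinearMap.fderiv]
    rfl
  simp only [map_sum, VField.sum_apply, D.leibniz, hd, zero_smul, zero_add, hc] at h
  change bump (E := E) x₀ x • bump (E := E) x₀ x • D.toFun X Y x = _ at h
  simp only [hb1, one_smul, bumpComponent_apply, frame_apply] at h
  rw [h]
  simp only [map_sum, map_add, map_smul, tcoord_tvec hx, Finset.sum_add_distrib]
  congr 1
  · exact (Module.finBasis ℝ E).sum_repr _
  · conv_rhs => rw [← (Module.finBasis ℝ E).sum_repr (Y.coord x₀ x)]
    simp only [map_sum, map_smul, VField.sum_apply]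
    simp

/-- The Christoffel symbols of `D` in the chart at `x₀`, multiplied by `-2`. -/
def AffineConnection.christoffel (x₀ x : M) : E →L[ℝ] E →L[ℝ] E :=
  LinearMap.toContinuousBilinearMap
    ((-2 : ℝ) • (D.toFun.compl₁₂ (frame x₀) (frame x₀)).compr₂
      { toFun := fun Z : VField 𝓘(ℝ, E) M ↦ Z.coord x₀ x
        map_add' := fun Z Z' ↦ by rw [VField.coord_add, Pi.add_apply]
        map_smul' := fun c Z ↦ by rw [VField.coord_smul, Pi.smul_apply, RingHom.id_apply] })

theorem AffineConnection.christoffel_apply (x₀ x : M) (u v : E) :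
    D.christoffel x₀ x u v = (-2 : ℝ) • (D.toFun (frame x₀ u) (frame x₀ v)).coord x₀ x := rfl

theorem AffineConnection.contMDiffAt_christoffel (x₀ : M) :
    ContMDiffAt 𝓘(ℝ, E) 𝓘(ℝ, E →L[ℝ] E →L[ℝ] E) ∞ (D.christoffel x₀) x₀ :=
  contMDiffAt_clm_of_apply fun u ↦ contMDiffAt_clm_of_apply fun v ↦
    (contMDiffAt_const (I' := 𝓘(ℝ, ℝ))).smul
      ((D.toFun (frame x₀ u) (frame x₀ v)).contMDiffAt_coord (mem_chart_source E x₀))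

/-- The factor `-2` in `christoffel` undoes the `-1/2` in `chartNabla`. -/
theorem AffineConnection.coord_toFun {x₀ x : M} (hx : x ∈ (chartAt E x₀).source)
    (hb : bump (E := E) x₀ =ᶠ[𝓝 x] 1) (X Y : VField 𝓘(ℝ, E) M) :
    (D.toFun X Y).coord x₀ x = chartNabla x₀ (D.christoffel x₀ x) X Y x := by
  refine (D.toFun_right_eq hx hb X Y).trans ?_
  rw [D.left_eq_frame hb.eq_of_nhds, chartNabla, D.christoffel_apply, smul_smul]
  norm_num
  rfl

theorem AffineConnection.coord_toFun_self (x : M) (X Y : VField 𝓘(ℝ, E) M) :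
    (D.toFun X Y).coord x x = chartNabla x (D.christoffel x x) X Y x :=
  D.coord_toFun (mem_chart_source E x) (bump x).eventuallyEq_one X Y

/-- Both jets induce the value of `D` at `x`, and a symmetric jet is determined by the connection it
induces there. This replaces the transformation law of Christoffel symbols. -/
theorem AffineConnection.symJet_christoffel {x₀ x : M} (hx : x ∈ (chartAt E x₀).source)
    (hb : bump (E := E) x₀ =ᶠ[𝓝 x] 1) :
    symJet x (D.christoffel x x) x = symJet x₀ (D.christoffel x₀ x) x := by
  have : CompleteSpace E := FiniteDimensional.complete ℝ E
  have hxx := mem_chart_source E x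
  have hs := isSymmetricAt_symJet (D.christoffel x x) hxx
  refine hs.eq_of_gam_eq hx (isSymmetricAt_symJet _ hx) ?_
  rw [gam_symJet _ hx]
  refine gam_eq_of_chartNabla_eq hx fun X Y ↦ ?_
  obtain ⟨b, hbj⟩ := hs.exists_localBisection
  rw [← D.coord_toFun hx hb, ← tcoord_mlieBracket_act_eq hx hs b hbj]
  refine congrArg (tcoord x₀ x) (tcoord_injective hxx ?_)
  rw [tcoord_mlieBracket_act_eq hxx hs b hbj, gam_symJet _ hxx]
  exact (D.coord_toFun_self x X Y).symm

/-- The symmetry jet whose associated connection is `D`. -/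
def AffineConnection.symmetryJet : SymmetryJet 𝓘(ℝ, E) M where
  toFun x := symJet x (D.christoffel x x) x
  contMDiff_toFun x₀ := by
    -- The definition uses a different chart at each point; near `x₀` it may be computed in the
    -- single chart at `x₀`, where smoothness is known.
    refine (contMDiffAt_symJet (D.contMDiffAt_christoffel x₀)).congr_of_eventuallyEq ?_
    filter_upwards [(chartAt E x₀).open_source.mem_nhds (mem_chart_source E x₀),
      (bump (E := E) x₀).eventuallyEq_one.eventuallyEq_nhds] with x hx hb
    exact D.symJet_christoffel hx hb
  src_toFun _ := rfl
  isSemiHolonomic x := by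
    have : CompleteSpace E := FiniteDimensional.complete ℝ E
    have hx := mem_chart_source E x
    obtain ⟨b, hb⟩ := exists_localBisection_symJet (D.christoffel x x) hx
    rw [← hb]
    exact IsSymmetricAt.isSemiHolonomic (by rw [hb]; exact isSymmetricAt_symJet _ hx)
  p_toFun x := (isSymmetricAt_symJet _ (mem_chart_source E x)).tgt_eq

variable [CompleteSpace E]

theorem AffineConnection.connection_symmetryJet : D.symmetryJet.connection = D := by
  ext X Y : 3
  refine VField.ext_coord fun x ↦ ?_
  rw [D.coord_toFun_self]
  refine (D.symmetryJet.coord_nablaField X Y x).trans ?_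
  rw [← gam_symJet (D.christoffel x x) (mem_chart_source E x)]
  rfl

theorem SymmetryJet.connection_injective :
    Function.Injective (SymmetryJet.connection (E := E) (M := M)) := by
  intro s s' h
  ext x : 2
  have hx := mem_chart_source E x
  refine (s.isSymmetricAt x).eq_of_gam_eq hx (s'.isSymmetricAt x)
    (gam_eq_of_chartNabla_eq hx fun X Y ↦ ?_)
  rw [← s.coord_nablaField, ← s'.coord_nablaField]
  exact congrArg (fun D : AffineConnection 𝓘(ℝ, E) M ↦ (D.toFun X Y).coord x x) h

theorem SymmetryJet.connection_bijective :
    Function.Bijective (SymmetryJet.connection (E := E) (M := M)) :=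
  ⟨connection_injective, fun D ↦ ⟨D.symmetryJet, D.connection_symmetryJet⟩⟩

end Christoffel

/-! ### Torsion as the antisymmetric part of `gam`. -/

section Torsion

variable {E : Type*} [NormedAddCommGroup E] [NormedSpace ℝ E] [CompleteSpace E]
  {M : Type*} [TopologicalSpace M] [ChartedSpace E M] [IsManifold 𝓘(ℝ, E) ∞ M]

/-- The derivative terms of the two covariant derivatives form the coordinate bracket and cancel
against it. -/
theorem SymmetryJet.tcoord_torsion (s : SymmetryJet 𝓘(ℝ, E) M) (X Y : VField 𝓘(ℝ, E) M) (x : M) :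
    tcoord x x (s.connection.toFun X Y x - s.connection.toFun Y X x -
      VectorField.mlieBracket 𝓘(ℝ, E) X Y x) =
    (1 / 2 : ℝ) • (gam x (s.toFun x) (Y.coord x x) (X.coord x x) -
      gam x (s.toFun x) (X.coord x x) (Y.coord x x)) := by
  have hx := mem_chart_source E x
  have hb := tcoord_mlieBracket hx ((X.contMDiff x).mdifferentiableAt (by simp))
    ((Y.contMDiff x).mdifferentiableAt (by simp))
  change _ = mvfderiv 𝓘(ℝ, E) (Y.coord x) x (X x) - mvfderiv 𝓘(ℝ, E) (X.coord x) x (Y x) at hb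
  have h (X Y : VField 𝓘(ℝ, E) M) := s.coord_nablaField X Y x
  refine (map_sub (tcoord x x) _ _).trans ?_
  refine (congrArg₂ (· - ·) ((map_sub (tcoord x x) _ _).trans
    (congrArg₂ (· - ·) (h X Y) (h Y X))) hb).trans ?_
  simp only [chartNabla, smul_sub]
  abel

variable [FiniteDimensional ℝ E] [T2Space M]

theorem SymmetryJet.isTorsionFree_iff (s : SymmetryJet 𝓘(ℝ, E) M) :
    s.connection.IsTorsionFree ↔
      ∀ x u v, gam x (s.toFun x) u v = gam x (s.toFun x) v u := by
  refine ⟨fun h x u v ↦ ?_, fun h X Y x ↦ ?_⟩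
  · have hx := mem_chart_source E x
    obtain ⟨X, rfl⟩ := exists_vField_coord hx v
    obtain ⟨Y, rfl⟩ := exists_vField_coord hx u
    have h1 := s.tcoord_torsion X Y x
    rw [h X Y x, map_zero, eq_comm, smul_eq_zero] at h1
    exact sub_eq_zero.1 (h1.resolve_left (by norm_num))
  · apply tcoord_injective (mem_chart_source E x)
    rw [s.tcoord_torsion, h x, sub_self, smul_zero, map_zero]

end Torsion

/-! ### Holonomic jets and symmetric second order parts. -/

section Holonomic

variable {E : Type*} [NormedAddCommGroup E] [NormedSpace ℝ E]
  {M : Type*} [TopologicalSpace M] [ChartedSpace E M] {x₀ x : M} {f : M → M}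

/-- The expression of a map in the preferred chart at `x₀`. -/
def localRep (x₀ : M) (f : M → M) : E → E :=
  extChartAt 𝓘(ℝ, E) x₀ ∘ f ∘ (extChartAt 𝓘(ℝ, E) x₀).symm

theorem localRep_comp_eventuallyEq (hx : x ∈ (chartAt E x₀).source) :
    extChartAt 𝓘(ℝ, E) x₀ ∘ f =ᶠ[𝓝 x] localRep x₀ f ∘ extChartAt 𝓘(ℝ, E) x₀ := by
  filter_upwards [(chartAt E x₀).open_source.mem_nhds hx] with z hz
  have hz' : z ∈ (extChartAt 𝓘(ℝ, E) x₀).source := by simpa using hz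
  simp only [localRep, Function.comp_apply, (extChartAt 𝓘(ℝ, E) x₀).left_inv hz']

variable [IsManifold 𝓘(ℝ, E) ∞ M]

theorem contDiffAt_localRep {n : ℕ∞} (hx : x ∈ (chartAt E x₀).source)
    (hfx : f x ∈ (chartAt E x₀).source)
    (hf : ContMDiffAt 𝓘(ℝ, E) 𝓘(ℝ, E) n f x) :
    ContDiffAt ℝ n (localRep x₀ f) (extChartAt 𝓘(ℝ, E) x₀ x) := by
  have hx' : x ∈ (extChartAt 𝓘(ℝ, E) x₀).source := by simpa using hx
  have hn : (n : WithTop ℕ∞) ≤ ∞ := by exact_mod_cast le_top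
  rw [← contMDiffAt_iff_contDiffAt]
  refine ContMDiffAt.comp (I' := 𝓘(ℝ, E)) (g := extChartAt 𝓘(ℝ, E) x₀ ∘ f) _ ?_
    ((contMDiffOn_extChartAt_symm x₀).contMDiffAt
      ((isOpen_extChartAt_target x₀).mem_nhds ((extChartAt 𝓘(ℝ, E) x₀).map_source hx')) |>.of_le hn)
  rw [(extChartAt 𝓘(ℝ, E) x₀).left_inv hx']
  exact ((contMDiffAt_extChartAt' hfx).of_le hn).comp x hf

theorem jcoord_ofMap (hx : x ∈ (chartAt E x₀).source) (hfx : f x ∈ (chartAt E x₀).source)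
    (hf : ContMDiffAt 𝓘(ℝ, E) 𝓘(ℝ, E) 1 f x) :
    jcoord x₀ (Jet1.ofMap 𝓘(ℝ, E) 𝓘(ℝ, E) f x) =
      fderiv ℝ (localRep x₀ f) (extChartAt 𝓘(ℝ, E) x₀ x) := by
  ext v
  change tcoord x₀ (f x) (mfderiv 𝓘(ℝ, E) 𝓘(ℝ, E) f x (tvec x₀ x v)) = _
  rw [tcoord_eq_mvfderiv hfx,
    ← mvfderiv_comp_mfderiv (I' := 𝓘(ℝ, E)) rfl (mdifferentiableAt_extChartAt hfx)
    (hf.mdifferentiableAt (by simp)), mvfderiv_congr (localRep_comp_eventuallyEq hx),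
    mvfderiv_fderiv_comp ((contDiffAt_localRep (n := 1) hx hfx hf).differentiableAt (by simp))
      (mdifferentiableAt_extChartAt hx), ← tcoord_eq_mvfderiv hx, tcoord_tvec hx]

theorem contMDiffAt_ofMap (hf : ContMDiffAt 𝓘(ℝ, E) 𝓘(ℝ, E) ∞ f x) :
    ContMDiffAt 𝓘(ℝ, E) (jetModel 𝓘(ℝ, E) 𝓘(ℝ, E)) ∞ (Jet1.ofMap 𝓘(ℝ, E) 𝓘(ℝ, E) f) x :=
  (contMDiffAt_jet_iff_inCoordinates (x₀ := x) (y₀ := f x) (mem_chart_source E x)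
    (mem_chart_source E (f x))).2 ⟨contMDiffAt_id, hf, hf.mfderiv_const (m := ∞) (by simp)⟩

/-- The coordinate of `j¹_z f` is the derivative of the local representative, so one more
differentiation gives its second derivative. -/
theorem gam_ofMap_ofMap (hx : x ∈ (chartAt E x₀).source) (hfx : f x ∈ (chartAt E x₀).source)
    (hf : ContMDiffAt 𝓘(ℝ, E) 𝓘(ℝ, E) ∞ f x) :
    gam x₀ (Jet1.ofMap 𝓘(ℝ, E) (jetModel 𝓘(ℝ, E) 𝓘(ℝ, E)) (Jet1.ofMap 𝓘(ℝ, E) 𝓘(ℝ, E) f) x) =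
      fderiv ℝ (fderiv ℝ (localRep x₀ f)) (extChartAt 𝓘(ℝ, E) x₀ x) := by
  ext1 v
  refine (gam_ofMap ((contMDiffAt_ofMap hf).mdifferentiableAt (by simp)) hx hfx v).trans ?_
  have h : (fun z ↦ jcoord x₀ (Jet1.ofMap 𝓘(ℝ, E) 𝓘(ℝ, E) f z)) =ᶠ[𝓝 x]
      fderiv ℝ (localRep x₀ f) ∘ extChartAt 𝓘(ℝ, E) x₀ := by
    filter_upwards [(chartAt E x₀).open_source.mem_nhds hx,
      contMDiffAt_iff_contMDiffAt_nhds (by simp) |>.1 (hf.of_le (n := ∞) (m := 1) (by simp)),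
      hf.continuousAt.preimage_mem_nhds ((chartAt E x₀).open_source.mem_nhds hfx)] with z h1 h2 h3
    exact jcoord_ofMap h1 h3 h2
  have hd : DifferentiableAt ℝ (fderiv ℝ (localRep x₀ f)) (extChartAt 𝓘(ℝ, E) x₀ x) :=
    ((contDiffAt_localRep (n := ⊤) hx hfx hf).fderiv_right
      (m := ∞) (by simp)).differentiableAt (by simp)
  rw [mvfderiv_congr h, mvfderiv_fderiv_comp hd (mdifferentiableAt_extChartAt hx),
    ← tcoord_eq_mvfderiv hx, tcoord_tvec hx]

/-- Symmetry of second derivatives, applied to the local representative of `f`. -/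
theorem IsSymmetricAt.gam_symm_of_isHolonomic {θ : Jet11 𝓘(ℝ, E) M} (h : IsSymmetricAt x θ)
    (hθ : IsHolonomic θ) (u v : E) : gam x θ u v = gam x θ v u := by
  obtain ⟨f, hxf, hf⟩ := hθ
  rw [h.src_eq] at hxf hf
  subst hf
  have hfx : f x = x := congrArg Jet1.tgt h.tgt_eq
  have hc : ContMDiffAt 𝓘(ℝ, E) 𝓘(ℝ, E) ∞ f x :=
    f.contMDiffOn_toFun.contMDiffAt (f.open_source.mem_nhds hxf)
  have hx := mem_chart_source E x
  have hx' : f x ∈ (chartAt E x).source := by rwa [hfx]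
  have hg := gam_ofMap_ofMap hx hx' hc
  refine (DFunLike.congr_fun (DFunLike.congr_fun hg u) v).trans
    (Eq.trans ?_ (DFunLike.congr_fun (DFunLike.congr_fun hg v) u).symm)
  exact (contDiffAt_localRep (n := ⊤) hx hx' hc).isSymmSndFDerivAt (by
    rw [minSmoothness_of_isRCLikeNormedField]
    exact ENat.LEInfty.out) u v

/-- The polynomial map fixing `a` with first derivative `-1` and second derivative `Γ` at `a`. -/
def quadraticReflection (a : E) (Γ : E →L[ℝ] E →L[ℝ] E) (u : E) : E :=
  a - (u - a) + (1 / 2 : ℝ) • Γ (u - a) (u - a)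

theorem quadraticReflection_self (a : E) (Γ : E →L[ℝ] E →L[ℝ] E) :
    quadraticReflection a Γ a = a := by
  simp [quadraticReflection]

theorem contDiff_quadraticReflection (a : E) (Γ : E →L[ℝ] E →L[ℝ] E) :
    ContDiff ℝ ∞ (quadraticReflection a Γ) := by
  unfold quadraticReflection
  fun_prop

/-- Symmetry of `Γ` merges the two terms of the product rule, and the factor `1/2` absorbs the
resulting `2`. -/
theorem fderiv_quadraticReflection {a : E} {Γ : E →L[ℝ] E →L[ℝ] E} (hΓ : ∀ u v, Γ u v = Γ v u) :
    fderiv ℝ (quadraticReflection a Γ) = fun u ↦ -ContinuousLinearMap.id ℝ E + Γ (u - a) := by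
  ext u v
  have h1 : HasFDerivAt (fun u : E ↦ u - a) (ContinuousLinearMap.id ℝ E) u :=
    (hasFDerivAt_id u).sub_const a
  have h2 : HasFDerivAt (fun u : E ↦ Γ (u - a)) Γ u := Γ.hasFDerivAt.comp u h1
  have h := ((h1.const_sub a).add ((h2.clm_apply h1).const_smul (1 / 2 : ℝ))).fderiv
  refine (congrArg (fun A : E →L[ℝ] E ↦ A v) h).trans ?_
  simp only [add_apply, neg_apply, smul_apply, ContinuousLinearMap.comp_apply,
    ContinuousLinearMap.flip_apply, ContinuousLinearMap.id_apply, hΓ v (u - a), ← two_smul ℝ,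
    smul_smul]
  norm_num

theorem fderiv_fderiv_quadraticReflection {a : E} {Γ : E →L[ℝ] E →L[ℝ] E}
    (hΓ : ∀ u v, Γ u v = Γ v u) (u : E) :
    fderiv ℝ (fderiv ℝ (quadraticReflection a Γ)) u = Γ := by
  rw [fderiv_quadraticReflection hΓ, fderiv_const_add, fderiv_comp_sub]
  exact Γ.fderiv

/-- A symmetric jet with symmetric second order part is the 2-jet of a map that is quadratic in
the preferred chart. -/
theorem IsSymmetricAt.isHolonomic_of_gam_symm [CompleteSpace E] {θ : Jet11 𝓘(ℝ, E) M}
    (h : IsSymmetricAt x θ) (hθ : ∀ u v, gam x θ u v = gam x θ v u) : IsHolonomic θ := by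
  have hx := mem_chart_source E x
  have hx' : x ∈ (extChartAt 𝓘(ℝ, E) x).source := mem_extChartAt_source x
  let φ := extChartAt 𝓘(ℝ, E) x
  let F := quadraticReflection (φ x) (gam x θ)
  have hF : ContDiff ℝ ∞ F := contDiff_quadraticReflection _ _
  have hFx : F (φ x) = φ x := quadraticReflection_self _ _
  let q : M → M := φ.symm ∘ F ∘ φ
  have hqx : q x = x := by
    change φ.symm (F (φ x)) = x
    rw [hFx, φ.left_inv hx']
  let W : Set M := φ.source ∩ φ ⁻¹' (F ⁻¹' φ.target)
  have hW : IsOpen W := (continuousOn_extChartAt x).isOpen_inter_preimage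
    (isOpen_extChartAt_source x) ((isOpen_extChartAt_target x).preimage hF.continuous)
  have hxW : x ∈ W := ⟨hx', by
    change F (φ x) ∈ φ.target
    rw [hFx]
    exact φ.map_source hx'⟩
  have hq : ContMDiffOn 𝓘(ℝ, E) 𝓘(ℝ, E) ∞ q W :=
    (contMDiffOn_extChartAt_symm x).comp (hF.contMDiff.comp_contMDiffOn
      (contMDiffOn_extChartAt.mono fun z hz ↦ by simpa [φ] using hz.1)) fun z hz ↦ hz.2
  have hqc : ContMDiffAt 𝓘(ℝ, E) 𝓘(ℝ, E) ∞ q x := hq.contMDiffAt (hW.mem_nhds hxW)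
  have hrep : localRep x q =ᶠ[𝓝 (φ x)] F := by
    have h1 : F ⁻¹' φ.target ∈ 𝓝 (φ x) :=
      ((isOpen_extChartAt_target x).preimage hF.continuous).mem_nhds hxW.2
    filter_upwards [h1, (isOpen_extChartAt_target x).mem_nhds (φ.map_source hx')] with u hu hu'
    change φ (φ.symm (F (φ (φ.symm u)))) = F u
    rw [φ.right_inv hu', φ.right_inv hu]
  have hneg : Jet1.ofMap 𝓘(ℝ, E) 𝓘(ℝ, E) q x = negId 𝓘(ℝ, E) x := by
    refine ofMap_eq_negId hx hqx (hqc.mdifferentiableAt (by simp)) fun v ↦ ?_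
    rw [mvfderiv_congr (localRep_comp_eventuallyEq hx), mvfderiv_fderiv_comp
      ((contDiffAt_localRep (n := ⊤) hx (by rwa [hqx]) hqc).differentiableAt (by simp))
      (mdifferentiableAt_extChartAt hx), hrep.fderiv_eq, ← tcoord_eq_mvfderiv hx,
      fderiv_quadraticReflection hθ]
    simp [φ]
  obtain ⟨Φ, hxΦ, hΦW, hΦ⟩ := exists_partialDiffeomorph hW hxW hq
    (isInvertible_mfderiv_of_ofMap_eq_negId hneg)
  have hjet : Jet1.ofMap 𝓘(ℝ, E) 𝓘(ℝ, E) Φ =ᶠ[𝓝 x] Jet1.ofMap 𝓘(ℝ, E) 𝓘(ℝ, E) q := by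
    filter_upwards [Φ.open_source.mem_nhds hxΦ] with z hz
    exact Jet1.ofMap_congr (Filter.eventuallyEq_of_mem (Φ.open_source.mem_nhds hz) hΦ)
  refine ⟨Φ, by rwa [h.src_eq], ?_⟩
  rw [h.src_eq]
  refine Eq.trans ?_ (Jet1.ofMap_congr hjet).symm
  -- Both jets are symmetric at `x`, so it suffices to compare their second order parts.
  refine h.eq_of_gam_eq hx (isSymmetricAt_ofMap
    ((contMDiffAt_ofMap hqc).mdifferentiableAt (by simp)) hneg
    (Filter.Eventually.of_forall fun _ ↦ rfl) hneg) ?_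
  rw [gam_ofMap_ofMap hx (by rwa [hqx]) hqc, hrep.fderiv.fderiv_eq,
    fderiv_fderiv_quadraticReflection hθ]

end Holonomic

section HolonomicIff

variable {E : Type*} [NormedAddCommGroup E] [NormedSpace ℝ E] [FiniteDimensional ℝ E]
  {M : Type*} [TopologicalSpace M] [ChartedSpace E M] [IsManifold 𝓘(ℝ, E) ∞ M] [T2Space M]
  [CompleteSpace E]

theorem SymmetryJet.isHolonomic_iff (s : SymmetryJet 𝓘(ℝ, E) M) :
    s.IsHolonomic ↔ s.connection.IsTorsionFree := by
  rw [s.isTorsionFree_iff]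
  exact forall_congr' fun x ↦ ⟨(s.isSymmetricAt x).gam_symm_of_isHolonomic,
    (s.isSymmetricAt x).isHolonomic_of_gam_symm⟩

end HolonomicIff

end SymJet

end

open SymJet in
theorem proposition2p2
    {E : Type*} [NormedAddCommGroup E] [NormedSpace ℝ E] [FiniteDimensional ℝ E]
    {M : Type*} [TopologicalSpace M] [T2Space M] [ChartedSpace E M]
    [IsManifold 𝓘(ℝ, E) ∞ M] :
    ∃ Φ : SymmetryJet 𝓘(ℝ, E) M → AffineConnection 𝓘(ℝ, E) M,
      (∀ (s : SymmetryJet 𝓘(ℝ, E) M) (x : M) (b : LocalBisection 𝓘(ℝ, E) x),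
        b.jet = s.toFun x →
        ∀ X Y : VField 𝓘(ℝ, E) M,
          (Φ s).toFun X Y x =
            (1 / 2 : ℝ) • VectorField.mlieBracket 𝓘(ℝ, E) X (fun y ↦ Y y + b.act Y y) x) ∧
      Function.Bijective Φ ∧
      ∀ s : SymmetryJet 𝓘(ℝ, E) M, s.IsHolonomic ↔ (Φ s).IsTorsionFree := by
  have : CompleteSpace E := FiniteDimensional.complete ℝ E
  exact ⟨SymmetryJet.connection, fun s x b hb X Y ↦ s.nabla_eq_mlieBracket b hb X Y,
    SymmetryJet.connection_bijective, SymmetryJet.isHolonomic_iff⟩
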